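/- Conventions. For a positive (i.e. $\langle Ax,x\rangle\ge 0$ on $D(A)$) self-adjoint operator $A$ in a complex Hilbert space $H$, $A^{1/2}$ is its positive self-adjoint square root, $A^0=I$ with $D(A^0)=H$, $A^{(j+1)/2}v=A^{j/2}(A^{1/2}v)$ on the natural domain, and $D(A^{j/2})$ carries the norm $\|v\|_{D(A^{j/2})}^2=\sum_{i=0}^{j}\|A^{i/2}v\|^2$. For $f\in C^0([0,T];H)$ a solution of $$v''+Av=f \text{ on } [0,T],\qquad v(0)=g,\quad v'(0)=h \tag{P}$$ is a function $v\in C^0([0,T];D(A^{1/2}))\cap C^1([0,T];H)$ with $v(0)=g$, $v'(0)=h$ and, for all $w\in D(A^{1/2})$ and $t\in[0,T]$, $\frac{d}{dt}\langle v'(t),w\rangle+\langle A^{1/2}v(t),A^{1/2}w\rangle=\langle f(t),w\rangle$. Theorem. Let $m\ge 0$ be an integer and $T>0$. There is a constant $C>0$, depending only on $m$ and $T$, such that the following holds for every positive self-adjoint operator $A$ in a complex Hilbert space. Assume $g\in D(A^{(m+1)/2})$, $h\in D(A^{m/2})$ and $$\partial_t^k f\in C^0([0,T];D(A^{(m-k)/2})),\qquad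 k=0,\dots,m.$$ Then (P) has a unique solution $v$, it satisfies $$\partial_t^k v\in C^0([0,T];D(A^{(m+1-k)/2})),\qquad k=0,1,\dots,m+1,$$ and $$\sum_{k=0}^{m+1}\sup_{t\in[0,T]}\|\partial_t^k v(t)\|_{D(A^{(m+1-k)/2})}\le C\Big(\sum_{k=0}^{m}\sup_{t\in[0,T]}\|\partial_t^k f(t)\|_{D(A^{(m-k)/2})}+\|g\|_{D(A^{(m+1)/2})}+\|h\|_{D(A^{m/2})}\Big).$$ In particular, let $n\ge2$, let $\omega\subset\mathbb R^{n-1}$ be open and bounded, $\Omega=\omega\times\mathbb R$, and let $c:\Omega\to\mathbb R$ be measurable and bounded with $c\ge c_m$ a.e. in $\Omega$ for some constant $c_m>0$. Then the operator $A=-\nabla\cdot c\nabla$ in $L^2(\Omega)$ generated by the closed form $u\mapsto\int_\Omega c|\nabla u|^2\,dx$ with domain $H^1_0(\Omega)$ is self-adjoint and positive, and the above holds for it, with the same $C$. -/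

import Mathlib

open Set Filter Topology MeasureTheory
open scoped ComplexConjugate

namespace HypReg

noncomputable section

/-! ### Half-integer powers of a positive self-adjoint operator -/

section Abstract

variable {H : Type*} [NormedAddCommGroup H] [InnerProductSpace ℂ H]

/-- The product `B ∘ S` of two unbounded operators, on its natural domain
`{x ∈ D(S) : S x ∈ D(B)}`. -/
def opMul (B S : H →ₗ.[ℂ] H) : H →ₗ.[ℂ] H where
  domain :=
    { carrier := {x | ∃ hx : x ∈ S.domain, S ⟨x, hx⟩ ∈ B.domain}
      add_mem' := by
        rintro x y ⟨hx, hx'⟩ ⟨hy, hy'⟩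
        refine ⟨S.domain.add_mem hx hy, ?_⟩
        have h := S.map_add ⟨x, hx⟩ ⟨y, hy⟩
        rw [AddMemClass.mk_add_mk] at h
        rw [h]
        exact B.domain.add_mem hx' hy'
      zero_mem' := by
        refine ⟨S.domain.zero_mem, ?_⟩
        have h : S ⟨0, S.domain.zero_mem⟩ = 0 := S.map_zero
        rw [h]
        exact B.domain.zero_mem
      smul_mem' := by
        rintro a x ⟨hx, hx'⟩
        refine ⟨S.domain.smul_mem a hx, ?_⟩
        have h := S.map_smul a ⟨x, hx⟩
        rw [SetLike.mk_smul_mk] at h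
        rw [h]
        exact B.domain.smul_mem a hx' }
  toFun :=
    { toFun := fun x => B ⟨S ⟨x.1, x.2.1⟩, x.2.2⟩
      map_add' := by
        intro x y
        rw [← B.map_add]
        congr 1
        apply Subtype.ext
        exact S.map_add ⟨x.1, x.2.1⟩ ⟨y.1, y.2.1⟩
      map_smul' := by
        intro a x
        rw [RingHom.id_apply, ← B.map_smul]
        congr 1
        apply Subtype.ext
        exact S.map_smul a ⟨x.1, x.2.1⟩ }

/-- Positivity of an unbounded operator: `⟨A x, x⟩ ≥ 0` for every `x ∈ D(A)`. -/
def IsNonneg (A : H →ₗ.[ℂ] H) : Prop :=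
  ∀ x : A.domain, 0 ≤ (inner ℂ (A x) (x : H)).re

/-- `S` is a positive self-adjoint operator with `S² = A` (equality of unbounded operators, domains
included). A positive self-adjoint `A` has exactly one such `S`, the operator `A^{1/2}` that the
spectral theorem provides. -/
def IsPosSqrt [CompleteSpace H] (S A : H →ₗ.[ℂ] H) : Prop :=
  IsSelfAdjoint S ∧ IsNonneg S ∧ opMul S S = A

open Classical in
/-- The positive self-adjoint square root `A^{1/2}` of a positive self-adjoint operator `A`. -/
def sqrtOp [CompleteSpace H] (A : H →ₗ.[ℂ] H) : H →ₗ.[ℂ] H :=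
  if h : ∃ S, IsPosSqrt S A then h.choose else ⊥

/-- `halfPow A j` is `A^{j/2}`: `A^0` is the identity with domain `H`, and
`A^{(j+1)/2} v = A^{j/2} (A^{1/2} v)` on the natural domain. -/
def halfPow [CompleteSpace H] (A : H →ₗ.[ℂ] H) : ℕ → (H →ₗ.[ℂ] H)
  | 0 => (LinearMap.id : H →ₗ[ℂ] H).toPMap ⊤
  | j + 1 => opMul (halfPow A j) (sqrtOp A)

open Classical in
/-- The value `B x` of an unbounded operator, extended by `0` off the domain. -/
def ev (B : H →ₗ.[ℂ] H) (x : H) : H :=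
  if hx : x ∈ B.domain then B ⟨x, hx⟩ else 0

/-- The Hilbert norm `(∑_{i ≤ j} ‖A^{i/2} x‖²)^{1/2}` of `D(A^{j/2})`; it is meant for
`x ∈ D(A^{j/2})`. -/
def domNorm [CompleteSpace H] (A : H →ₗ.[ℂ] H) (j : ℕ) (x : H) : ℝ :=
  Real.sqrt (∑ i ∈ Finset.range (j + 1), ‖ev (halfPow A i) x‖ ^ 2)

/-- `u ∈ C⁰([0,T]; D(A^{j/2}))`, the target carrying the norm `domNorm A j`. -/
def ContIntoDom [CompleteSpace H] (A : H →ₗ.[ℂ] H) (j : ℕ) (T : ℝ) (u : ℝ → H) : Prop :=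
  (∀ t ∈ Icc 0 T, u t ∈ (halfPow A j).domain) ∧
  ∀ t ∈ Icc 0 T, Tendsto (fun s => domNorm A j (u s - u t)) (𝓝[Icc 0 T] t) (𝓝 0)

/-- The norm `sup_{t ∈ [0,T]} ‖u(t)‖_{D(A^{j/2})}` of `C⁰([0,T]; D(A^{j/2}))`. -/
def supDomNorm [CompleteSpace H] (A : H →ₗ.[ℂ] H) (j : ℕ) (T : ℝ) (u : ℝ → H) : ℝ :=
  ⨆ t : Icc (0 : ℝ) T, domNorm A j (u t)

/-- The time derivative `∂_t^k u` on `[0,T]` (one-sided at the end points). -/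
def dt [CompleteSpace H] (k : ℕ) (T : ℝ) (u : ℝ → H) : ℝ → H :=
  iteratedDerivWithin k u (Icc 0 T)

/-- `∂_t^k u ∈ C⁰([0,T]; D(A^{(p-k)/2}))` for `k = 0, …, p`. For `k = p` this contains
`u ∈ C^p([0,T]; H)`, which makes the derivatives meaningful. -/
def TimeRegular [CompleteSpace H] (A : H →ₗ.[ℂ] H) (p : ℕ) (T : ℝ) (u : ℝ → H) : Prop :=
  ContDiffOn ℝ p u (Icc 0 T) ∧ ∀ k ≤ p, ContIntoDom A (p - k) T (dt k T u)

/-- `v` is a solution on `[0,T]` of `v'' + A v = f`, `v(0) = g`, `v'(0) = h`, where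
`v ∈ C⁰([0,T]; D(A^{1/2})) ∩ C¹([0,T]; H)` and the equation is understood in the dual space
of `D(A^{1/2})`: for every `w ∈ D(A^{1/2})` and `t ∈ [0,T]`,
`d/dt ⟨w, v'(t)⟩ + ⟨A^{1/2} w, A^{1/2} v(t)⟩ = ⟨w, f(t)⟩`. -/
def IsSolution [CompleteSpace H] (A : H →ₗ.[ℂ] H) (T : ℝ) (f : ℝ → H) (g h : H)
    (v : ℝ → H) : Prop :=
  TimeRegular A 1 T v ∧
  (∀ w ∈ (sqrtOp A).domain, ∀ t ∈ Icc 0 T,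
    HasDerivWithinAt (fun s => inner ℂ w (dt 1 T v s))
      (inner ℂ w (f t) - inner ℂ (ev (sqrtOp A) w) (ev (sqrtOp A) (v t))) (Icc 0 T) t) ∧
  v 0 = g ∧ dt 1 T v 0 = h

/-- Well-posedness of order `m` with constant `C` of the problem `v'' + A v = f`, `v(0) = g`,
`v'(0) = h` on `[0,T]`: for data of regularity `m` there is a solution of regularity `m + 1`
obeying the a priori estimate, and it is the only solution. -/
def WellPosed [CompleteSpace H] (A : H →ₗ.[ℂ] H) (m : ℕ) (T C : ℝ) : Prop :=
  ∀ (f : ℝ → H) (g h : H),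
    g ∈ (halfPow A (m + 1)).domain → h ∈ (halfPow A m).domain → TimeRegular A m T f →
    ∃ v : ℝ → H,
      IsSolution A T f g h v ∧
      TimeRegular A (m + 1) T v ∧
      (∀ w : ℝ → H, IsSolution A T f g h w → EqOn w v (Icc 0 T)) ∧
      ∑ k ∈ Finset.range (m + 2), supDomNorm A (m + 1 - k) T (dt k T v) ≤
        C * (∑ k ∈ Finset.range (m + 1), supDomNorm A (m - k) T (dt k T f)
          + domNorm A (m + 1) g + domNorm A m h)

end Abstract

/-! ### The operator `-∇ ⬝ c ∇` with Dirichlet condition -/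

section Concrete

variable {N : ℕ}

/-- The complex Hilbert space `L²(Ω)`. -/
abbrev L2 (Ω : Set (EuclideanSpace ℝ (Fin N))) : Type :=
  Lp ℂ 2 (volume.restrict Ω)

open scoped ContDiff in
/-- The pairs `(φ, ∇φ)` in `L²(Ω) × L²(Ω)^N` with `φ ∈ C_c^∞(Ω)`. -/
def testPairs (Ω : Set (EuclideanSpace ℝ (Fin N))) :
    Submodule ℂ (L2 Ω × (Fin N → L2 Ω)) where
  carrier := {p | ∃ φ : EuclideanSpace ℝ (Fin N) → ℂ,
    ContDiff ℝ ∞ φ ∧ HasCompactSupport φ ∧ tsupport φ ⊆ Ω ∧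
    (p.1 =ᵐ[volume.restrict Ω] φ) ∧
    ∀ i, p.2 i =ᵐ[volume.restrict Ω] fun x => fderiv ℝ φ x (EuclideanSpace.single i 1)}
  add_mem' := by
    rintro p q ⟨φ, h1, h2, h3, h4, h5⟩ ⟨ψ, k1, k2, k3, k4, k5⟩
    refine ⟨φ + ψ, h1.add k1, h2.add k2,
      (tsupport_add φ ψ).trans (union_subset h3 k3), ?_, fun i => ?_⟩
    · filter_upwards [Lp.coeFn_add p.1 q.1, h4, k4] with x hx hx1 hx2
      simp only [Prod.fst_add, hx, Pi.add_apply, hx1, hx2]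
    · filter_upwards [Lp.coeFn_add (p.2 i) (q.2 i), h5 i, k5 i] with x hx hx1 hx2
      simp only [Prod.snd_add, Pi.add_apply] at hx ⊢
      rw [hx, hx1, hx2, fderiv_add ((h1.differentiable (by simp)) x)
        ((k1.differentiable (by simp)) x)]
      rfl
  zero_mem' := by
    refine ⟨0, contDiff_const, HasCompactSupport.zero, by simp [tsupport], ?_, fun i => ?_⟩
    · exact Lp.coeFn_zero _ _ _
    · filter_upwards [Lp.coeFn_zero ℂ 2 (volume.restrict Ω)] with x hx
      simp only [Prod.snd_zero, Pi.zero_apply, fderiv_zero] at hx ⊢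
      exact hx
  smul_mem' := by
    rintro a p ⟨φ, h1, h2, h3, h4, h5⟩
    refine ⟨a • φ, contDiff_const.smul h1, h2.smul_left (f := fun _ => a),
      (tsupport_smul_subset_right (fun _ => a) φ).trans h3, ?_, fun i => ?_⟩
    · filter_upwards [Lp.coeFn_smul a p.1, h4] with x hx hx1
      simp only [Prod.smul_fst, hx, Pi.smul_apply, hx1]
    · filter_upwards [Lp.coeFn_smul a (p.2 i), h5 i] with x hx hx1
      simp only [Prod.smul_snd, Pi.smul_apply] at hx ⊢
      rw [hx, hx1, fderiv_const_smul ((h1.differentiable (by simp)) x)]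
      rfl

/-- `H_0^1(Ω)`, the closure of `C_c^∞(Ω)` in the topology of `H^1(Ω)`, where `u ∈ H^1(Ω)` is
represented by `(u, ∇u) ∈ L²(Ω) × L²(Ω)^N`. -/
def H01 (Ω : Set (EuclideanSpace ℝ (Fin N))) : Submodule ℂ (L2 Ω × (Fin N → L2 Ω)) :=
  (testPairs Ω).topologicalClosure

/-- A real conductivity on `Ω`: measurable, bounded, and bounded below by a positive constant. -/
structure Conductivity (Ω : Set (EuclideanSpace ℝ (Fin N))) where
  /-- the coefficient `c` -/
  toFun : EuclideanSpace ℝ (Fin N) → ℝ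
  aemeasurable : AEMeasurable toFun (volume.restrict Ω)
  elliptic : ∃ cm > 0, ∀ᵐ x ∂(volume.restrict Ω), cm ≤ toFun x
  bounded : ∃ cM, ∀ᵐ x ∂(volume.restrict Ω), toFun x ≤ cM

/-- The sesquilinear form `∑ᵢ ∫_Ω c Gᵢ \overline{Ψᵢ} dx` (for `G = ∇u`, `Ψ = ∇φ`). -/
def energy {Ω : Set (EuclideanSpace ℝ (Fin N))} (c : Conductivity Ω)
    (Ψ G : Fin N → L2 Ω) : ℂ :=
  ∑ i, ∫ x in Ω, (c.toFun x : ℂ) * (G i x * conj (Ψ i x))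

theorem energy_integrable {Ω : Set (EuclideanSpace ℝ (Fin N))} (c : Conductivity Ω)
    (a b : L2 Ω) :
    Integrable (fun x => (c.toFun x : ℂ) * (b x * conj (a x))) (volume.restrict Ω) := by
  obtain ⟨cm, h0, h1⟩ := c.elliptic
  obtain ⟨cM, h2⟩ := c.bounded
  have h := L2.integrable_inner (𝕜 := ℂ) a b
  simp only [RCLike.inner_apply] at h
  refine h.bdd_mul (c := cM)
    (Complex.measurable_ofReal.comp_aemeasurable c.aemeasurable).aestronglyMeasurable ?_
  filter_upwards [h1, h2] with x hx hx'
  simpa [abs_of_pos (h0.trans_le hx)] using hx'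

theorem energy_add {Ω : Set (EuclideanSpace ℝ (Fin N))} (c : Conductivity Ω)
    (Ψ G G' : Fin N → L2 Ω) : energy c Ψ (G + G') = energy c Ψ G + energy c Ψ G' := by
  unfold energy
  rw [← Finset.sum_add_distrib]
  refine Finset.sum_congr rfl fun i _ => ?_
  rw [← integral_add (energy_integrable c _ _) (energy_integrable c _ _)]
  refine integral_congr_ae ?_
  filter_upwards [Lp.coeFn_add (G i) (G' i)] with x hx
  simp only [Pi.add_apply] at hx ⊢
  rw [hx]; ring

theorem energy_smul {Ω : Set (EuclideanSpace ℝ (Fin N))} (c : Conductivity Ω)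
    (Ψ G : Fin N → L2 Ω) (a : ℂ) : energy c Ψ (a • G) = a * energy c Ψ G := by
  unfold energy
  rw [Finset.mul_sum]
  refine Finset.sum_congr rfl fun i _ => ?_
  rw [← integral_const_mul]
  refine integral_congr_ae ?_
  filter_upwards [Lp.coeFn_smul a (G i)] with x hx
  simp only [Pi.smul_apply] at hx ⊢
  rw [hx, smul_eq_mul]; ring

/-- The graph of the operator associated with the form: all `(u, w)` with `u ∈ H_0^1(Ω)`,
`w ∈ L²(Ω)` and `∫_Ω c ∇u ⬝ \overline{∇φ} = ∫_Ω w \overline{φ}` for every `φ ∈ H_0^1(Ω)`. -/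
def divGraph {Ω : Set (EuclideanSpace ℝ (Fin N))} (c : Conductivity Ω) :
    Submodule ℂ (L2 Ω × L2 Ω) where
  carrier := {p | ∃ G, (p.1, G) ∈ H01 Ω ∧ ∀ q ∈ H01 Ω, energy c q.2 G = inner ℂ q.1 p.2}
  add_mem' := by
    rintro p p' ⟨G, h1, h2⟩ ⟨G', k1, k2⟩
    refine ⟨G + G', (H01 Ω).add_mem h1 k1, fun q hq => ?_⟩
    rw [energy_add, h2 q hq, k2 q hq, Prod.snd_add, inner_add_right]
  zero_mem' := by
    refine ⟨0, (H01 Ω).zero_mem, fun q _ => ?_⟩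
    have h := energy_smul c q.2 0 0
    rw [zero_smul, zero_mul] at h
    rw [h, Prod.snd_zero, inner_zero_right]
  smul_mem' := by
    rintro a p ⟨G, h1, h2⟩
    refine ⟨a • G, (H01 Ω).smul_mem a h1, fun q hq => ?_⟩
    rw [energy_smul, h2 q hq, Prod.smul_snd, inner_smul_right]

/-- The operator `A_c = -∇ ⬝ c ∇` in `L²(Ω)` with homogeneous Dirichlet condition, generated by
the closed form `u ↦ ∫_Ω c |∇u|²`, `u ∈ H_0^1(Ω)`. -/
def divOp {Ω : Set (EuclideanSpace ℝ (Fin N))} (c : Conductivity Ω) : L2 Ω →ₗ.[ℂ] L2 Ω :=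
  (divGraph c).toLinearPMap

/-- The infinite cylinder `ω × ℝ` over `ω ⊆ ℝ^d`, as a subset of `ℝ^{d+1}`. -/
def cylinder {d : ℕ} (ω : Set (EuclideanSpace ℝ (Fin d))) :
    Set (EuclideanSpace ℝ (Fin (d + 1))) :=
  {x | WithLp.toLp 2 (fun i : Fin d => x i.castSucc) ∈ ω}

end Concrete

end

end HypReg

/-! Put S = A^{1/2}. With y = v' + iSv and z = v' - iSv the wave equation splits into y' = iSy + f
and z' = -iSz + f. Both are solved by Duhamel's formula for the groups exp(±itS), and v' = (y +
z)/2, Sv = (y - z)/(2i). The groups are unitary and commute with S, so each power of S passes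
through Duhamel's formula onto the data. This yields the spatial regularity and bounds that see A
only through the norms of the data, which is why one constant serves all A
(`exists_global_solution`). The norm of v itself follows by integrating v'.

Higher time derivatives come from v'' = f - S²v: two time derivatives are traded for two powers of S
(`TR.bootstrap`, `domNorm_dt_le`). Uniqueness is an energy identity one level below the natural
energy, where weak solutions may be tested (`IsSolution.eqOn`).

The spectral theorem for unbounded operators is avoided. Operators are handled through their graphs;
positivity and self-adjointness give the bounded resolvent R = (1 + A)⁻¹ (`exists_resolvent`). The
root S is assembled from the bounded roots of R and 1 - R (`exists_isPosSqrt`), and exp(itS) is a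
strong limit of exponentials of Yosida approximations (`exists_isPropagator`).

The divergence-form operator is covered by the abstract result once it is known to be positive and
self-adjoint. It is symmetric, and 1 + A is onto by an orthogonal projection in a Hilbert space
carrying the energy norm (`exists_resolvent_divOp`), which is enough by
`isSelfAdjoint_of_symm_of_range`. -/

namespace HypReg

noncomputable section

/-! ### Self-adjointness through graphs, and resolvents -/

section SelfAdjoint

variable {H : Type*} [NormedAddCommGroup H] [InnerProductSpace ℂ H]

theorem IsNonneg.graph {S : H →ₗ.[ℂ] H} (hp : IsNonneg S) {x y : H} (h : (x, y) ∈ S.graph) :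
    0 ≤ (inner ℂ y x).re := by
  obtain ⟨z, rfl, rfl⟩ := (S.mem_graph_iff).1 h
  exact hp z

theorem isNonneg_of_graph {S : H →ₗ.[ℂ] H}
    (h : ∀ x y, (x, y) ∈ S.graph → 0 ≤ (inner ℂ y x).re) : IsNonneg S :=
  fun x => h _ _ (S.mem_graph x)

theorem mem_opMul_graph {B S : H →ₗ.[ℂ] H} {x z : H} :
    (x, z) ∈ (opMul B S).graph ↔ ∃ y, (x, y) ∈ S.graph ∧ (y, z) ∈ B.graph := by
  constructor
  · intro h
    obtain ⟨w, hw, rfl⟩ := ((opMul B S).mem_graph_iff).1 h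
    obtain ⟨w, h1, h2⟩ := w
    simp only at hw
    subst hw
    exact ⟨_, S.mem_graph ⟨w, h1⟩, B.mem_graph ⟨_, h2⟩⟩
  · rintro ⟨y, h1, h2⟩
    obtain ⟨x, rfl, rfl⟩ := (S.mem_graph_iff).1 h1
    obtain ⟨y, h3, rfl⟩ := (B.mem_graph_iff).1 h2
    have hx : (x : H) ∈ (opMul B S).domain := ⟨x.2, (show (y : H) = S x from h3) ▸ y.2⟩
    have : opMul B S ⟨x, hx⟩ = B y := by
      change B ⟨S ⟨x.1, _⟩, _⟩ = B y
      congr 1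
      exact Subtype.ext h3.symm
    rw [← this]
    exact (opMul B S).mem_graph ⟨x, hx⟩

variable [CompleteSpace H]

theorem isSelfAdjoint_iff_graph {S : H →ₗ.[ℂ] H} :
    IsSelfAdjoint S ↔ Dense (S.domain : Set H) ∧
      ∀ z u, (z, u) ∈ S.graph ↔ ∀ x y, (x, y) ∈ S.graph → inner ℂ y z = inner ℂ x u := by
  have key : Dense (S.domain : Set H) → ∀ z u, (z, u) ∈ S.adjoint.graph ↔
      ∀ x y, (x, y) ∈ S.graph → inner ℂ y z = inner ℂ x u := by
    intro hd z u
    rw [LinearPMap.adjoint_graph_eq_graph_adjoint hd, Submodule.mem_adjoint_iff]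
    simp only [sub_eq_zero]
  constructor
  · intro h
    refine ⟨h.dense_domain, fun z u => ?_⟩
    rw [← key h.dense_domain, LinearPMap.isSelfAdjoint_def.1 h]
  · rintro ⟨hd, h⟩
    rw [LinearPMap.isSelfAdjoint_def]
    refine LinearPMap.eq_of_eq_graph ?_
    ext ⟨z, u⟩
    rw [key hd, h]

theorem graph_inner {S : H →ₗ.[ℂ] H} (hS : IsSelfAdjoint S) {x y z u : H} (h : (x, y) ∈ S.graph) (h' : (z, u) ∈ S.graph) :
    inner ℂ y z = inner ℂ x u :=
  ((isSelfAdjoint_iff_graph.1 hS).2 z u).1 h' x y h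

theorem mem_graph_of_inner {S : H →ₗ.[ℂ] H} (hS : IsSelfAdjoint S) {z u : H}
    (h : ∀ x y, (x, y) ∈ S.graph → inner ℂ y z = inner ℂ x u) : (z, u) ∈ S.graph :=
  ((isSelfAdjoint_iff_graph.1 hS).2 z u).2 h

/-- A vector is determined by its inner products with the domain. -/
theorem eq_of_inner_graph {S : H →ₗ.[ℂ] H} (hS : IsSelfAdjoint S) {u v : H}
    (h : ∀ x y, (x, y) ∈ S.graph → inner ℂ x u = inner ℂ x v) : u = v :=
  hS.dense_domain.eq_of_inner_right ℂ fun x hx => h x _ (S.mem_graph ⟨x, hx⟩)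

/-- Surjectivity of 1 + A does both jobs. If w is orthogonal to D(A) and w = x + Ax, testing with x
gives ‖x‖² + ⟨Ax, x⟩ = 0, so w = 0 and D(A) is dense. If (z, u) lies in the adjoint graph, solve x +
Ax = u + z; then z - x is orthogonal to the range of 1 + A, so z = x. -/
theorem isSelfAdjoint_of_symm_of_range {A : H →ₗ.[ℂ] H} (hp : IsNonneg A)
    (hs : ∀ x y z u, (x, y) ∈ A.graph → (z, u) ∈ A.graph → inner ℂ y z = inner ℂ x u)
    (hr : ∀ w, ∃ x, (x, w - x) ∈ A.graph) : IsSelfAdjoint A := by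
  rw [isSelfAdjoint_iff_graph]
  constructor
  · rw [Submodule.dense_iff_topologicalClosure_eq_top, Submodule.topologicalClosure_eq_top_iff,
      Submodule.eq_bot_iff]
    intro w hw
    obtain ⟨x, hx⟩ := hr w
    have h0 : inner ℂ w x = 0 := by
      have := hw x (LinearPMap.mem_domain_of_mem_graph hx)
      rw [← inner_conj_symm, this, map_zero]
    have h1 := hp.graph hx
    rw [inner_sub_left, h0, zero_sub, Complex.neg_re] at h1
    have h2 : (inner ℂ x x).re = ‖x‖ ^ 2 := inner_self_eq_norm_sq (𝕜 := ℂ) x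
    have hx0 : x = 0 := by
      rw [← norm_eq_zero]; nlinarith [norm_nonneg x]
    subst hx0
    simpa using LinearPMap.graph_fst_eq_zero_snd A hx rfl
  · intro z u
    refine ⟨fun h x y hxy => hs x y z u hxy h, fun h => ?_⟩
    obtain ⟨x, hx⟩ := hr (u + z)
    suffices z = x by
      subst this
      simpa using hx
    rw [← sub_eq_zero, ← inner_self_eq_zero (𝕜 := ℂ)]
    obtain ⟨y, hy⟩ := hr (z - x)
    have h1 := h y _ hy
    have h2 := hs y _ x _ hy hx
    have h3 : inner ℂ (z - x - y) (z - x) = inner ℂ y (x - z) := by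
      rw [inner_sub_right, h1, h2, ← inner_sub_right]
      congr 1
      abel
    rw [inner_sub_left, ← neg_sub z x, inner_neg_right] at h3
    linear_combination h3

/-- The resolvent `(S + l)⁻¹` of a positive self-adjoint operator. -/
theorem exists_resolvent {S : H →ₗ.[ℂ] H} (hS : IsSelfAdjoint S) (hp : IsNonneg S)
    {l : ℝ} (hl : 0 < l) :
    ∃ R : H →L[ℂ] H, (∀ w, (R w, w - (l : ℂ) • R w) ∈ S.graph) ∧
      (∀ x y, (x, y) ∈ S.graph → R (y + (l : ℂ) • x) = x) ∧ (∀ w, l * ‖R w‖ ≤ ‖w‖) ∧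
      (∀ x y, inner ℂ (R x) y = inner ℂ x (R y)) := by
  -- Positivity makes the cross term 2l Re⟨y, x⟩ nonnegative. Hence (x, y) ↦ y + lx is bounded below
  -- on the closed graph: it is injective with closed range.
  have low : ∀ x y, (x, y) ∈ S.graph →
      ‖y‖ ^ 2 + l ^ 2 * ‖x‖ ^ 2 ≤ ‖y + (l : ℂ) • x‖ ^ 2 := by
    intro x y h
    have h1 := hp.graph h
    rw [norm_add_sq (𝕜 := ℂ), inner_smul_right, norm_smul, Complex.norm_real, Real.norm_eq_abs,
      mul_pow, sq_abs]
    have : RCLike.re ((l : ℂ) * inner ℂ y x) = l * (inner ℂ y x).re := by simp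
    rw [this]
    nlinarith [mul_nonneg hl.le h1]
  let L : S.graph →L[ℂ] H :=
    ((ContinuousLinearMap.snd ℂ H H) + (l : ℂ) • (ContinuousLinearMap.fst ℂ H H)).comp
      S.graph.subtypeL
  have hL : ∀ p : S.graph, L p = p.1.2 + (l : ℂ) • p.1.1 := fun p => rfl
  have hcl : IsClosed (S.graph : Set (H × H)) := hS.isClosed
  have : CompleteSpace S.graph := hcl.completeSpace_coe
  have hb : ∃ K, AntilipschitzWith K L := by
    refine ⟨(1 + l⁻¹).toNNReal, ContinuousLinearMap.antilipschitz_of_bound L fun p => ?_⟩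
    have h := low p.1.1 p.1.2 p.2
    rw [hL, Real.coe_toNNReal _ (by positivity)]
    set n := ‖p.1.2 + (l : ℂ) • p.1.1‖ with hn
    have n0 : 0 ≤ n := norm_nonneg _
    have h1 : ‖p.1.2‖ ≤ n := by
      refine abs_le_of_sq_le_sq' ?_ n0 |>.2
      nlinarith [mul_nonneg (sq_nonneg l) (sq_nonneg ‖p.1.1‖)]
    have h2 : l * ‖p.1.1‖ ≤ n := by
      refine abs_le_of_sq_le_sq' ?_ n0 |>.2
      nlinarith [sq_nonneg ‖p.1.2‖]
    have h3 : ‖p.1.1‖ ≤ l⁻¹ * n := by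
      rw [inv_mul_eq_div, le_div_iff₀ hl]; linarith
    have h4 : ‖p‖ = max ‖p.1.1‖ ‖p.1.2‖ := rfl
    rw [h4]
    have : 0 ≤ l⁻¹ * n := by positivity
    refine max_le ?_ ?_ <;> nlinarith
  obtain ⟨K, hK⟩ := hb
  have hrange : L.range = ⊤ := by
    have hc : IsClosed (L.range : Set H) := by
      have h : IsClosed (range L) := hK.isClosed_range L.uniformContinuous
      exact h
    rw [← hc.submodule_topologicalClosure_eq, Submodule.topologicalClosure_eq_top_iff,
      Submodule.eq_bot_iff]
    intro u hu
    -- A vector orthogonal to the range of S + l would be an eigenvector for -l, which positivity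
    -- excludes.
    have hg : (u, -(l : ℂ) • u) ∈ S.graph := by
      refine mem_graph_of_inner hS fun x y hxy => ?_
      have := hu (L ⟨(x, y), hxy⟩) ⟨_, rfl⟩
      rw [hL, inner_add_left, inner_smul_left, Complex.conj_ofReal] at this
      rw [inner_smul_right]
      linear_combination this
    have h1 := hp.graph hg
    rw [inner_smul_left] at h1
    have h2 : inner ℂ u u = ((‖u‖ ^ 2 : ℝ) : ℂ) := by
      rw [inner_self_eq_norm_sq_to_K]; norm_cast
    rw [h2] at h1
    have h3 : (conj (-(l : ℂ)) * ((‖u‖ ^ 2 : ℝ) : ℂ)).re = - (l * ‖u‖ ^ 2) := by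
      rw [map_neg, Complex.conj_ofReal, ← Complex.ofReal_neg, ← Complex.ofReal_mul,
        Complex.ofReal_re]
      ring
    rw [h3] at h1
    have : ‖u‖ ^ 2 = 0 := le_antisymm (by nlinarith) (sq_nonneg _)
    simpa using this
  have hinj : L.ker = ⊥ := LinearMap.ker_eq_bot.2 hK.injective
  let e := ContinuousLinearEquiv.ofBijective L hinj hrange
  let R : H →L[ℂ] H := (ContinuousLinearMap.fst ℂ H H).comp
    (S.graph.subtypeL.comp (e.symm : H →L[ℂ] S.graph))
  have he : ∀ w, (e.symm w).1.2 + (l : ℂ) • R w = w := fun w => by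
    have := e.apply_symm_apply w
    exact this
  have hR : ∀ w, (R w, w - (l : ℂ) • R w) ∈ S.graph := fun w => by
    have h1 : w - (l : ℂ) • R w = (e.symm w).1.2 := by
      rw [sub_eq_iff_eq_add]; exact (he w).symm
    rw [h1]
    exact (e.symm w).2
  refine ⟨R, hR, ?_, ?_, ?_⟩
  · intro x y h
    have : e.symm (y + (l : ℂ) • x) = ⟨(x, y), h⟩ := by
      rw [ContinuousLinearEquiv.symm_apply_eq]
      rfl
    change (e.symm (y + (l : ℂ) • x)).1.1 = x
    rw [this]
  · intro w
    have := low _ _ (hR w)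
    rw [sub_add_cancel] at this
    refine abs_le_of_sq_le_sq' ?_ (norm_nonneg _) |>.2
    nlinarith [sq_nonneg ‖w - (l : ℂ) • R w‖]
  · intro x y
    have := graph_inner hS (hR x) (hR y)
    rw [inner_sub_left, inner_sub_right, inner_smul_left, inner_smul_right,
      Complex.conj_ofReal] at this
    linear_combination -this

end SelfAdjoint

/-! ### The positive square root -/

section SquareRoot

variable {H : Type*} [NormedAddCommGroup H] [InnerProductSpace ℂ H]

theorem inner_apply_of_nonneg {B : H →L[ℂ] H} (hB : 0 ≤ B) (x y : H) :
    inner ℂ (B x) y = inner ℂ x (B y) :=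
  ((ContinuousLinearMap.nonneg_iff_isPositive B).1 hB).isSymmetric x y

theorem re_inner_apply_nonneg {B : H →L[ℂ] H} (hB : 0 ≤ B) (x : H) :
    0 ≤ (inner ℂ (B x) x).re :=
  ((ContinuousLinearMap.nonneg_iff_isPositive B).1 hB).re_inner_nonneg_left x

variable [CompleteSpace H]

/-- The closed operator `E ∘ B⁻¹`, for commuting positive `B`, `E` with `B² + E² = 1`. -/
theorem isPosSqrt_of_commute {A : H →ₗ.[ℂ] H} {R B E : H →L[ℂ] H}
    (hR : ∀ w, (R w, w - R w) ∈ A.graph) (hR' : ∀ x y, (x, y) ∈ A.graph → R (y + x) = x)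
    (hB : 0 ≤ B) (hE : 0 ≤ E) (hc : ∀ x, B (E x) = E (B x)) (hBR : ∀ x, B (B x) = R x)
    (hBE : ∀ x, B (B x) + E (E x) = x) (hpos : ∀ x, 0 ≤ (inner ℂ (E x) (B x)).re) :
    ∃ S, IsPosSqrt S A := by
  have hRinj : ∀ w, R w = 0 → w = 0 := by
    intro w hw
    have := hR w
    rw [hw, sub_zero] at this
    exact LinearPMap.graph_fst_eq_zero_snd A this rfl
  have hBinj : ∀ w, B w = 0 → w = 0 := fun w hw => hRinj w (by rw [← hBR, hw, map_zero])
  -- The model is B = (1 + A)^{-1/2} and E = A^{1/2}(1 + A)^{-1/2}, so w ↦ (Bw, Ew) should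
  -- parametrize the graph of A^{1/2}. By `hBE` the parameter of a point (x, y) is w = Bx + Ey; this
  -- formula supplies the witness in the adjoint condition below.
  let g : Submodule ℂ (H × H) := (B.prod E).range
  have hg : ∀ x y, (x, y) ∈ g ↔ ∃ w, B w = x ∧ E w = y := by
    intro x y
    constructor
    · rintro ⟨w, hw⟩
      exact ⟨w, congrArg Prod.fst hw, congrArg Prod.snd hw⟩
    · rintro ⟨w, rfl, rfl⟩
      exact ⟨w, rfl⟩
  have hS : ∀ x y, (x, y) ∈ g.toLinearPMap.graph ↔ ∃ w, B w = x ∧ E w = y := by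
    intro x y
    rw [Submodule.toLinearPMap_graph_eq, hg]
    rintro ⟨x, y⟩ h hx
    obtain ⟨w, h1, h2⟩ := (hg _ _).1 h
    simp only at hx
    rw [← h2, hBinj w (h1.trans hx), map_zero]
  refine ⟨g.toLinearPMap, ?_, ?_, ?_⟩
  · rw [isSelfAdjoint_iff_graph]
    constructor
    · rw [Submodule.dense_iff_topologicalClosure_eq_top,
        Submodule.topologicalClosure_eq_top_iff, Submodule.eq_bot_iff]
      intro w hw
      refine hBinj w (ext_inner_left ℂ fun v => ?_)
      have := hw (B v) (LinearPMap.mem_domain_of_mem_graph ((hS _ _).2 ⟨v, rfl, rfl⟩))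
      rw [← inner_apply_of_nonneg hB, this, inner_zero_right]
    · intro z u
      constructor
      · intro h x y hxy
        obtain ⟨w, rfl, rfl⟩ := (hS _ _).1 h
        obtain ⟨v, rfl, rfl⟩ := (hS _ _).1 hxy
        rw [inner_apply_of_nonneg hE, inner_apply_of_nonneg hB, hc]
      · intro h
        have h1 : E z = B u := by
          refine ext_inner_left ℂ fun v => ?_
          rw [← inner_apply_of_nonneg hB, ← inner_apply_of_nonneg hE]
          exact h _ _ ((hS _ _).2 ⟨v, rfl, rfl⟩)
        refine (hS _ _).2 ⟨B z + E u, ?_, ?_⟩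
        · rw [map_add, hc, ← h1, hBE]
        · rw [map_add, ← hc, h1, hBE]
  · refine isNonneg_of_graph fun x y h => ?_
    obtain ⟨w, rfl, rfl⟩ := (hS _ _).1 h
    exact hpos w
  · refine LinearPMap.eq_of_eq_graph ?_
    ext ⟨x, z⟩
    rw [mem_opMul_graph]
    constructor
    · rintro ⟨y, h1, h2⟩
      obtain ⟨w, rfl, rfl⟩ := (hS _ _).1 h1
      obtain ⟨v, h3, rfl⟩ := (hS _ _).1 h2
      have h4 : B (B w + E v) = w := by rw [map_add, hc, h3, hBE]
      have h5 := hR (B w + E v)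
      rwa [← hBR, h4, add_sub_cancel_left] at h5
    · intro h
      have h1 := hR' _ _ h
      refine ⟨E (B (z + x)), (hS _ _).2 ⟨B (z + x), by rw [hBR, h1], rfl⟩,
        (hS _ _).2 ⟨E (z + x), hc _, ?_⟩⟩
      have h2 := hBE (z + x)
      rw [hBR, h1] at h2
      have h3 : x + E (E (z + x)) = x + z := by rw [h2, add_comm]
      exact add_left_cancel h3

/-- The resolvent R = (1 + A)⁻¹ satisfies 0 ≤ R ≤ 1, so the continuous functional calculus provides
commuting roots of R and 1 - R, and their quotient is the root of A. -/
theorem exists_isPosSqrt {A : H →ₗ.[ℂ] H} (hA : IsSelfAdjoint A) (hp : IsNonneg A) :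
    ∃ S, IsPosSqrt S A := by
  obtain ⟨R, hR, hR', -, hsym⟩ := exists_resolvent hA hp one_pos
  simp only [Complex.ofReal_one, one_smul] at hR hR'
  have hR0 : 0 ≤ R := by
    rw [ContinuousLinearMap.nonneg_iff_isPositive]
    refine ⟨hsym, fun x => ?_⟩
    have := hp.graph (hR x)
    rw [inner_sub_left, Complex.sub_re] at this
    have h2 : (0 : ℝ) ≤ (inner ℂ (R x) (R x)).re := inner_self_nonneg (𝕜 := ℂ)
    have h3 : (inner ℂ (R x) x).re = (inner ℂ x (R x)).re := by rw [hsym]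
    change 0 ≤ (inner ℂ (R x) x).re
    linarith
  have hR1 : 0 ≤ 1 - R := by
    rw [ContinuousLinearMap.nonneg_iff_isPositive]
    refine ⟨fun x y => ?_, fun x => ?_⟩
    · change inner ℂ (x - R x) y = inner ℂ x (y - R y)
      rw [inner_sub_left, inner_sub_right, hsym]
    · have := hp.graph (hR x)
      have h3 : inner ℂ (x - R x) x = inner ℂ (x - R x) (R x) + inner ℂ (x - R x) (x - R x) := by
        rw [← inner_add_right]; congr 1; abel
      have h2 : (0 : ℝ) ≤ (inner ℂ (x - R x) (x - R x)).re := inner_self_nonneg (𝕜 := ℂ)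
      change 0 ≤ (inner ℂ (x - R x) x).re
      rw [h3, Complex.add_re]
      linarith
  set B := CFC.sqrt R with hB
  set E := CFC.sqrt (1 - R) with hE
  -- The fourth root of R serves only to rewrite ⟨Ex, Bx⟩ as ⟨E(Fx), Fx⟩, which is visibly
  -- nonnegative.
  set F := CFC.sqrt B with hF
  have hB0 : 0 ≤ B := CFC.sqrt_nonneg R
  have hE0 : 0 ≤ E := CFC.sqrt_nonneg _
  have hF0 : 0 ≤ F := CFC.sqrt_nonneg _
  have c0 : Commute R (1 - R) := (Commute.one_right R).sub_right (Commute.refl R)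
  have c1 : Commute B (1 - R) := c0.cfcₙ_nnreal _
  have c2 : Commute B E := (c1.symm.cfcₙ_nnreal _).symm
  have c3 : Commute F E := c2.cfcₙ_nnreal _
  have hBB : B * B = R := CFC.sqrt_mul_sqrt_self R
  have hEE : E * E = 1 - R := CFC.sqrt_mul_sqrt_self (1 - R)
  have hFF : F * F = B := CFC.sqrt_mul_sqrt_self B
  refine isPosSqrt_of_commute hR hR' hB0 hE0 (fun x => congrArg (· x) c2.eq)
    (fun x => congrArg (· x) hBB) (fun x => ?_) (fun x => ?_)
  · have h1 : B (B x) = R x := congrArg (· x) hBB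
    have h2 : E (E x) = x - R x := congrArg (· x) hEE
    rw [h1, h2, add_sub_cancel]
  · have h1 : B x = F (F x) := congrArg (· x) hFF.symm
    have h2 : F (E x) = E (F x) := congrArg (· x) c3.eq
    rw [h1, ← inner_apply_of_nonneg hF0, h2]
    exact re_inner_apply_nonneg hE0 _

/-- Existence is all that is needed of the root. The equation and the norms are phrased through the
chosen one, so its uniqueness plays no role in the argument. -/
theorem sqrtOp_spec {A : H →ₗ.[ℂ] H} (hA : IsSelfAdjoint A) (hp : IsNonneg A) :
    IsPosSqrt (sqrtOp A) A := by
  have h := exists_isPosSqrt hA hp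
  rw [sqrtOp, dif_pos h]
  exact h.choose_spec

end SquareRoot

/-! ### The unitary group exp(itS) -/

section UnitaryGroup

variable {H : Type*} [NormedAddCommGroup H] [InnerProductSpace ℂ H]

/-- `U t = exp (t τ S)` for a self-adjoint operator `S` and `τ = ± i`: a strongly continuous
unitary family that leaves `S` invariant and satisfies `U' = τ U S` on `D(S)`. -/
structure IsPropagator (S : H →ₗ.[ℂ] H) (τ : ℂ) (U : ℝ → H →L[ℂ] H) : Prop where
  adj : ∀ t x y, inner ℂ (U t x) y = inner ℂ x (U (-t) y)
  inv : ∀ t x, U t (U (-t) x) = x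
  zero : ∀ x, U 0 x = x
  norm : ∀ t x, ‖U t x‖ = ‖x‖
  cont : ∀ x, Continuous fun t => U t x
  graph : ∀ t x y, (x, y) ∈ S.graph → (U t x, U t y) ∈ S.graph
  deriv : ∀ t x y, (x, y) ∈ S.graph → HasDerivAt (fun t => U t x) (τ • U t y) t

theorem IsPropagator.neg {S : H →ₗ.[ℂ] H} {τ : ℂ} {U : ℝ → H →L[ℂ] H} (hU : IsPropagator S τ U) :
    IsPropagator S (-τ) fun t => U (-t) where
  adj t x y := hU.adj _ _ _
  inv t x := hU.inv _ _
  zero x := by simpa using hU.zero x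
  norm t x := hU.norm _ _
  cont x := (hU.cont x).comp continuous_neg
  graph t x y h := hU.graph _ _ _ h
  deriv t x y h := by
    have := (hU.deriv (-t) x y h).scomp t (hasDerivAt_neg t)
    simpa [Function.comp_def] using this

/-- Strong convergence of contractions on a dense set extends to the whole space. -/
theorem tendsto_of_dense {V : ℕ → H →L[ℂ] H} (hV : ∀ n x, ‖V n x‖ ≤ ‖x‖) {D : Set H}
    (hD : Dense D) (h : ∀ x ∈ D, Tendsto (fun n => V n x) atTop (𝓝 x)) (x : H) :
    Tendsto (fun n => V n x) atTop (𝓝 x) := by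
  rw [Metric.tendsto_atTop]
  intro ε hε
  obtain ⟨y, hy, hxy⟩ := Metric.dense_iff.1 hD x (ε / 3) (by positivity)
  obtain ⟨N, hN⟩ := Metric.tendsto_atTop.1 (h y hxy) (ε / 3) (by positivity)
  refine ⟨N, fun n hn => ?_⟩
  have h1 := hN n hn
  rw [Metric.mem_ball, dist_eq_norm] at hy
  rw [dist_eq_norm] at h1 ⊢
  have h2 := hV n (y - x)
  have h4 : V n x - x = (V n y - y) - V n (y - x) + (y - x) := by
    simp only [map_sub]; abel
  rw [h4]
  refine (norm_add_le _ _).trans_lt ?_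
  have := norm_sub_le (V n y - y) (V n (y - x))
  linarith

/-- A sequence of contractions that is strongly Cauchy on a dense set is strongly Cauchy. -/
theorem cauchySeq_of_dense {V : ℕ → H →L[ℂ] H} (hV : ∀ n x, ‖V n x‖ ≤ ‖x‖) {D : Set H}
    (hD : Dense D) (h : ∀ x ∈ D, CauchySeq fun n => V n x) (x : H) :
    CauchySeq fun n => V n x := by
  rw [Metric.cauchySeq_iff']
  intro ε hε
  obtain ⟨y, hy, hxy⟩ := Metric.dense_iff.1 hD x (ε / 3) (by positivity)
  obtain ⟨N, hN⟩ := Metric.cauchySeq_iff'.1 (h y hxy) (ε / 3) (by positivity)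
  refine ⟨N, fun n hn => ?_⟩
  have h1 := hN n hn
  rw [Metric.mem_ball, dist_eq_norm] at hy
  rw [dist_eq_norm] at h1 ⊢
  have h2 := hV n (y - x)
  have h3 := hV N (y - x)
  have h4 : V n x - V N x = (V n y - V N y) - V n (y - x) + V N (y - x) := by
    simp only [map_sub]; abel
  rw [h4]
  refine (norm_add_le _ _).trans_lt ?_
  have := norm_sub_le (V n y - V N y) (V n (y - x))
  linarith

variable [CompleteSpace H]

/-- `exp (i t B)` for a bounded symmetric operator `B`. -/
def expI (B : H →L[ℂ] H) (t : ℝ) : H →L[ℂ] H :=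
  NormedSpace.exp (t • (Complex.I • B))

theorem expI_hasDerivAt (B : H →L[ℂ] H) (t : ℝ) (x : H) :
    HasDerivAt (fun t => expI B t x) (Complex.I • expI B t (B x)) t := by
  have h := hasDerivAt_exp_smul_const (𝕂 := ℝ) (Complex.I • B) t
  have h2 := ((ContinuousLinearMap.apply ℂ H x).restrictScalars ℝ).hasFDerivAt.comp_hasDerivAt t h
  have h3 : ((ContinuousLinearMap.apply ℂ H x).restrictScalars ℝ)
      (NormedSpace.exp (t • Complex.I • B) * Complex.I • B) = Complex.I • expI B t (B x) := by
    change NormedSpace.exp (t • Complex.I • B) (Complex.I • B x) = _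
    rw [map_smul]
    rfl
  rw [h3] at h2
  exact h2

theorem expI_commute {B C : H →L[ℂ] H} (h : Commute C B) (t : ℝ) : Commute C (expI B t) := by
  unfold expI
  let _ := NormedAlgebra.restrictScalars ℚ ℂ (H →L[ℂ] H)
  exact ((h.smul_right _).smul_right _).exp_right

theorem expI_add {B C : H →L[ℂ] H} (h : Commute B C) (t : ℝ) :
    expI (B + C) t = expI B t * expI C t := by
  unfold expI
  let _ := NormedAlgebra.restrictScalars ℚ ℂ (H →L[ℂ] H)
  rw [smul_add, smul_add, NormedSpace.exp_add_of_commute]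
  exact (((h.smul_right _).smul_right _).smul_left _).smul_left _

theorem expI_zero (B : H →L[ℂ] H) : expI B 0 = 1 := by simp [expI]

theorem expI_adjoint {B : H →L[ℂ] H} (hB : ∀ x y, inner ℂ (B x) y = inner ℂ x (B y)) (t : ℝ)
    (x y : H) : inner ℂ (expI B t x) y = inner ℂ x (expI B (-t) y) := by
  have h1 : star B = B := ContinuousLinearMap.isSelfAdjoint_iff_isSymmetric.2 hB
  have h2 : star (expI B t) = expI B (-t) := by
    unfold expI
    let _ := NormedAlgebra.restrictScalars ℚ ℂ (H →L[ℂ] H)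
    rw [NormedSpace.star_exp, star_smul, star_smul, h1]
    simp
  rw [← h2, ContinuousLinearMap.star_eq_adjoint, ContinuousLinearMap.adjoint_inner_right]

theorem expI_neg_apply (B : H →L[ℂ] H) (t : ℝ) (x : H) : expI B (-t) (expI B t x) = x := by
  have h : expI B (-t) * expI B t = 1 := by
    unfold expI
    let _ := NormedAlgebra.restrictScalars ℚ ℂ (H →L[ℂ] H)
    rw [← NormedSpace.exp_add_of_commute, neg_smul, neg_add_cancel, NormedSpace.exp_zero]
    exact ((Commute.refl _).smul_left _).smul_right _
  exact congrArg (· x) h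

theorem expI_inner {B : H →L[ℂ] H} (hB : ∀ x y, inner ℂ (B x) y = inner ℂ x (B y)) (t : ℝ)
    (x y : H) : inner ℂ (expI B t x) (expI B t y) = inner ℂ x y := by
  rw [expI_adjoint hB, expI_neg_apply]

theorem expI_norm {B : H →L[ℂ] H} (hB : ∀ x y, inner ℂ (B x) y = inner ℂ x (B y)) (t : ℝ)
    (x : H) : ‖expI B t x‖ = ‖x‖ := by
  rw [@norm_eq_sqrt_re_inner ℂ, expI_inner hB, ← norm_eq_sqrt_re_inner]

theorem expI_sub_le {B : H →L[ℂ] H} (hB : ∀ x y, inner ℂ (B x) y = inner ℂ x (B y)) (s t : ℝ)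
    (x : H) : ‖expI B t x - expI B s x‖ ≤ ‖B x‖ * |t - s| := by
  have := Convex.norm_image_sub_le_of_norm_hasDerivWithin_le
    (fun r (_ : r ∈ univ) => (expI_hasDerivAt B r x).hasDerivWithinAt)
    (C := ‖B x‖) (fun r _ => by rw [norm_smul, Complex.norm_I, one_mul, expI_norm hB])
    convex_univ (mem_univ s) (mem_univ t)
  simpa using this

/-- Commuting exponentials factor as exp(itB) = exp(itC) exp(it(B - C)), and exp(itC) is an
isometry. The bound involves only (B - C)x, so strong convergence of the generators at x suffices.
-/
theorem expI_sub_expI_le {B C : H →L[ℂ] H} (hB : ∀ x y, inner ℂ (B x) y = inner ℂ x (B y))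
    (hC : ∀ x y, inner ℂ (C x) y = inner ℂ x (C y)) (h : Commute B C) (t : ℝ) (x : H) :
    ‖expI B t x - expI C t x‖ ≤ ‖B x - C x‖ * |t| := by
  have hD : ∀ x y, inner ℂ ((B - C) x) y = inner ℂ x ((B - C) y) := by
    intro x y
    simp only [sub_apply, inner_sub_left, inner_sub_right, hB, hC]
  have h1 : expI B t = expI C t * expI (B - C) t := by
    rw [← expI_add (h.symm.sub_right (Commute.refl C)), add_sub_cancel]
  rw [h1]
  change ‖expI C t (expI (B - C) t x) - expI C t x‖ ≤ _
  rw [← map_sub, expI_norm hC]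
  have := expI_sub_le hD 0 t x
  simpa [expI_zero] using this

/-- The existence half of Stone's theorem, by Yosida approximation. Since S ≥ 0, resolvents at
negative real points are available and the approximants are bounded and symmetric. -/
theorem exists_isPropagator {S : H →ₗ.[ℂ] H} (hS : IsSelfAdjoint S) (hp : IsNonneg S) :
    ∃ U, IsPropagator S Complex.I U := by
  choose! R hR hR' hRn hRs using fun l : ℝ => exists_resolvent hS hp (l := l)
  have hpos : ∀ n : ℕ, (0 : ℝ) < n + 1 := fun n => by positivity
  -- resolvents commute
  have hcomm : ∀ l k, 0 < l → 0 < k → Commute (R l) (R k) := by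
    intro l k hl hk
    rcases eq_or_ne l k with rfl | hne
    · exact Commute.refl _
    refine ContinuousLinearMap.ext fun w => ?_
    change R l (R k w) = R k (R l w)
    have h1 := S.graph.sub_mem (hR k hk w) (hR l hl w)
    have h2 := hR' l hl _ _ h1
    have h3 := hR' k hk _ _ h1
    have h4 : w - (k : ℂ) • R k w - (w - (l : ℂ) • R l w) + (l : ℂ) • (R k w - R l w) =
        ((l : ℂ) - k) • R k w := by module
    have h5 : w - (k : ℂ) • R k w - (w - (l : ℂ) • R l w) + (k : ℂ) • (R k w - R l w) =
        ((l : ℂ) - k) • R l w := by module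
    simp only [h4, h5, map_smul] at h2 h3
    have h6 : (l : ℂ) - k ≠ 0 := by
      rw [sub_ne_zero]; exact_mod_cast hne
    exact smul_right_injective H h6 (h2.trans h3.symm)
  -- With k = n + 1 and R k = (S + k)⁻¹ this is k(1 - k R k) = k S R k, which sends x ∈ D(S) to k R
  -- k (Sx).
  let B : ℕ → H →L[ℂ] H := fun n =>
    (((n : ℝ) + 1 : ℝ) : ℂ) • (1 - (((n : ℝ) + 1 : ℝ) : ℂ) • R (n + 1))
  have hB : ∀ n x y, inner ℂ (B n x) y = inner ℂ x (B n y) := by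
    intro n x y
    have := hRs (n + 1) (hpos n)
    simp only [B, smul_apply, sub_apply,
      one_apply_eq_self, inner_smul_left, inner_smul_right, inner_sub_left,
      inner_sub_right, this, Complex.conj_ofReal]
  have hBR : ∀ n l, 0 < l → Commute (R l) (B n) := by
    intro n l hl
    exact ((Commute.one_right _).sub_right ((hcomm l (n + 1) hl (hpos n)).smul_right _)).smul_right _
  have hBB : ∀ n m, Commute (B n) (B m) := by
    intro n m
    have := hBR m (n + 1) (hpos n)
    exact ((Commute.one_left _).sub_left (this.smul_left _)).smul_left _
  -- strong convergence on the domain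
  have hlim : ∀ x y, (x, y) ∈ S.graph → Tendsto (fun n => B n x) atTop (𝓝 y) := by
    -- The contractions k R k tend strongly to 1: on D(S) the error is R k (Sx), of norm at most
    -- ‖Sx‖/k, and D(S) is dense.
    have h1 : ∀ y, Tendsto (fun n : ℕ => ((((n : ℝ) + 1 : ℝ) : ℂ) • R (n + 1)) y) atTop (𝓝 y) := by
      refine tendsto_of_dense (fun n x => ?_) hS.dense_domain fun x hx => ?_
      · rw [smul_apply, norm_smul, Complex.norm_real, Real.norm_of_nonneg (hpos n).le]
        exact hRn _ (hpos n) x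
      · have hg := S.mem_graph ⟨x, hx⟩
        rw [tendsto_iff_norm_sub_tendsto_zero]
        refine squeeze_zero (fun _ => norm_nonneg _) (fun n => ?_)
          (tendsto_one_div_add_atTop_nhds_zero_nat.mul_const ‖S ⟨x, hx⟩‖ |>.trans_eq (by simp))
        have h2 := hR' _ (hpos n) _ _ hg
        rw [map_add, map_smul] at h2
        have h3 : ((((n : ℝ) + 1 : ℝ) : ℂ) • R (n + 1)) x - x = - R (n + 1) (S ⟨x, hx⟩) := by
          rw [smul_apply, sub_eq_iff_eq_add, ← sub_eq_neg_add, eq_sub_iff_add_eq, add_comm]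
          exact h2
        rw [h3, norm_neg, one_div_mul_eq_div, le_div_iff₀ (hpos n), mul_comm]
        exact hRn _ (hpos n) _
    intro x y h
    refine (h1 y).congr fun n => ?_
    have h2 := hR' _ (hpos n) _ _ h
    rw [map_add, map_smul] at h2
    change _ = (((n : ℝ) + 1 : ℝ) : ℂ) • (x - (((n : ℝ) + 1 : ℝ) : ℂ) • R (n + 1) x)
    rw [smul_apply]
    congr 1
    rw [eq_sub_iff_add_eq]
    exact h2
  have hcau : ∀ t x, CauchySeq fun n => expI (B n) t x := by
    intro t
    refine cauchySeq_of_dense (fun n x => (expI_norm (hB n) t x).le) hS.dense_domain ?_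
    intro x hx
    have h1 := (hlim x _ (S.mem_graph ⟨x, hx⟩)).cauchySeq
    rw [Metric.cauchySeq_iff'] at h1 ⊢
    intro ε hε
    obtain ⟨N, hN⟩ := h1 (ε / (|t| + 1)) (by positivity)
    refine ⟨N, fun n hn => ?_⟩
    have h2 := hN n hn
    rw [dist_eq_norm, lt_div_iff₀ (by positivity)] at h2
    rw [dist_eq_norm]
    have := expI_sub_expI_le (hB n) (hB N) (hBB n N) t x
    nlinarith [norm_nonneg (B n x - B N x)]
  choose U' hU' using fun t x => cauchySeq_tendsto_of_complete (hcau t x)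
  let U : ℝ → H →L[ℂ] H := fun t => continuousLinearMapOfTendsto (fun n => expI (B n) t)
    (f := U' t) (tendsto_pi_nhds.2 (hU' t))
  have hU : ∀ t x, Tendsto (fun n => expI (B n) t x) atTop (𝓝 (U t x)) := hU'
  have hinner : ∀ t x y, inner ℂ (U t x) (U t y) = inner ℂ x y := by
    intro t x y
    refine tendsto_nhds_unique ((hU t x).inner (hU t y)) ?_
    simp only [expI_inner (hB _)]
    exact tendsto_const_nhds
  have hadj : ∀ t x y, inner ℂ (U t x) y = inner ℂ x (U (-t) y) := by
    intro t x y
    refine tendsto_nhds_unique ((hU t x).inner tendsto_const_nhds) ?_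
    simp only [expI_adjoint (hB _)]
    exact tendsto_const_nhds.inner (hU (-t) y)
  have hnorm : ∀ t x, ‖U t x‖ = ‖x‖ := fun t x => by
    rw [@norm_eq_sqrt_re_inner ℂ, hinner, ← norm_eq_sqrt_re_inner]
  have hlip : ∀ s t x y, (x, y) ∈ S.graph → ‖U t x - U s x‖ ≤ ‖y‖ * |t - s| := by
    intro s t x y h
    exact le_of_tendsto_of_tendsto ((hU t x).sub (hU s x)).norm
      ((hlim x y h).norm.mul_const |t - s|) (Eventually.of_forall fun n => expI_sub_le (hB n) s t x)
  have hcont : ∀ x, Continuous fun t => U t x := by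
    intro x
    refine continuous_of_uniform_approx_of_continuous fun u hu => ?_
    obtain ⟨ε, hε, hu⟩ := Metric.mem_uniformity_dist.1 hu
    obtain ⟨y, hy, hyD⟩ := Metric.dense_iff.1 hS.dense_domain x ε hε
    refine ⟨fun t => U t y, ?_, fun t => hu ?_⟩
    · refine (LipschitzWith.of_dist_le_mul (K := ‖S ⟨y, hyD⟩‖₊) fun t s => ?_).continuous
      rw [dist_eq_norm, Real.dist_eq]
      exact hlip s t y _ (S.mem_graph ⟨y, hyD⟩)
    · rw [dist_eq_norm, ← map_sub, hnorm, ← dist_eq_norm, dist_comm]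
      exact hy
  refine ⟨U, hadj, ?_, ?_, hnorm, hcont, ?_, ?_⟩
  · intro t x
    refine ext_inner_right ℂ fun y => ?_
    rw [hadj, hinner]
  · intro x
    refine tendsto_nhds_unique (hU 0 x) ?_
    simp only [expI_zero, one_apply_eq_self]
    exact tendsto_const_nhds
  · intro t x y h
    -- As a limit of operators commuting with (S + 1)⁻¹, U t commutes with it as well; hence it
    -- preserves D(S) and commutes with S there.
    have h0 := hR' 1 one_pos _ _ h
    have h1 : Tendsto (fun n => R 1 (expI (B n) t (y + x))) atTop (𝓝 (R 1 (U t (y + x)))) :=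
      ((R 1).continuous.tendsto _).comp (hU t _)
    have h2 : ∀ n, R 1 (expI (B n) t (y + x)) = expI (B n) t x := by
      intro n
      have := congrArg (· (y + x)) (expI_commute (hBR n 1 one_pos) t).eq
      simp only [Complex.ofReal_one, one_smul] at h0
      simpa only [mul_apply_eq_comp, h0] using this
    simp only [h2] at h1
    have h3 := tendsto_nhds_unique h1 (hU t x)
    have h4 := hR 1 one_pos (U t (y + x))
    rw [h3, map_add, Complex.ofReal_one, one_smul, add_sub_cancel_right] at h4
    exact h4
  · intro t x y h
    have hBx := hlim x y h
    obtain ⟨K, hK⟩ := hBx.norm.bddAbove_range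
    have hK' : ∀ n, ‖B n x‖ ≤ K := fun n => hK ⟨n, rfl⟩
    have hderiv_cont : Continuous fun s => Complex.I • U s y := (hcont y).const_smul _
    -- Derivatives need not pass to the limit, but the integrated equation does, by dominated
    -- convergence with a bound on ‖B n x‖.
    have hint : ∀ t, U t x = U 0 x + ∫ s in (0 : ℝ)..t, Complex.I • U s y := by
      intro t
      have h1 : ∀ n, expI (B n) t x =
          expI (B n) 0 x + ∫ s in (0 : ℝ)..t, Complex.I • expI (B n) s (B n x) := by
        intro n
        have hc : Continuous fun s => Complex.I • expI (B n) s (B n x) :=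
          (continuous_iff_continuousAt.2 fun s =>
            (expI_hasDerivAt (B n) s (B n x)).continuousAt).const_smul _
        rw [intervalIntegral.integral_eq_sub_of_hasDerivAt
          (fun s _ => expI_hasDerivAt (B n) s x) (hc.intervalIntegrable _ _)]
        abel
      refine tendsto_nhds_unique (hU t x) ?_
      simp only [fun n => h1 n]
      refine (hU 0 x).add (intervalIntegral.tendsto_integral_filter_of_dominated_convergence
        (fun _ => K) (Eventually.of_forall fun n => ?_) (Eventually.of_forall fun n => ?_)
        (intervalIntegrable_const) (ae_of_all _ fun s _ => ?_))
      · have hc : Continuous fun s => Complex.I • expI (B n) s (B n x) :=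
          (continuous_iff_continuousAt.2 fun s =>
            (expI_hasDerivAt (B n) s (B n x)).continuousAt).const_smul _
        exact hc.aestronglyMeasurable
      · refine ae_of_all _ fun s _ => ?_
        rw [norm_smul, Complex.norm_I, one_mul, expI_norm (hB n)]
        exact hK' n
      · refine Tendsto.const_smul ?_ _
        have h2 : Tendsto (fun n => expI (B n) s (B n x - y)) atTop (𝓝 0) := by
          rw [tendsto_zero_iff_norm_tendsto_zero]
          simp only [expI_norm (hB _)]
          exact tendsto_iff_norm_sub_tendsto_zero.1 hBx
        have h3 := h2.add (hU s y)
        simpa [map_sub] using h3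
    have h1 := (intervalIntegral.integral_hasDerivAt_right (hderiv_cont.intervalIntegrable 0 t)
      (hderiv_cont.stronglyMeasurableAtFilter _ _) hderiv_cont.continuousAt).const_add (U 0 x)
    exact h1.congr_of_eventuallyEq (Eventually.of_forall hint)

end UnitaryGroup

/-! ### Iterates of S and continuity into their domains -/

section Powers

variable {H : Type*} [NormedAddCommGroup H] [InnerProductSpace ℂ H] {S : H →ₗ.[ℂ] H}

theorem ev_mem_graph {x : H} (hx : x ∈ S.domain) : (x, ev S x) ∈ S.graph := by
  rw [ev, dif_pos hx]
  exact S.mem_graph ⟨x, hx⟩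

theorem ev_eq {x y : H} (h : (x, y) ∈ S.graph) : ev S x = y :=
  S.mem_graph_snd_inj (ev_mem_graph (LinearPMap.mem_domain_of_mem_graph h)) h rfl

theorem ev_add {x y : H} (hx : x ∈ S.domain) (hy : y ∈ S.domain) :
    ev S (x + y) = ev S x + ev S y :=
  ev_eq (S.graph.add_mem (ev_mem_graph hx) (ev_mem_graph hy))

theorem ev_sub {x y : H} (hx : x ∈ S.domain) (hy : y ∈ S.domain) :
    ev S (x - y) = ev S x - ev S y :=
  ev_eq (S.graph.sub_mem (ev_mem_graph hx) (ev_mem_graph hy))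

theorem ev_smul {x : H} (c : ℂ) (hx : x ∈ S.domain) : ev S (c • x) = c • ev S x :=
  ev_eq (S.graph.smul_mem c (ev_mem_graph hx))

/-- `x ∈ D(S^j)`. -/
def InDom (S : H →ₗ.[ℂ] H) : ℕ → H → Prop
  | 0, _ => True
  | j + 1, x => x ∈ S.domain ∧ InDom S j (ev S x)

theorem InDom.of_le : ∀ {i j : ℕ} {x : H}, InDom S j x → i ≤ j → InDom S i x
  | 0, _, _, _, _ => trivial
  | _ + 1, 0, _, _, h => absurd h (by omega)
  | _ + 1, _ + 1, _, hx, h => ⟨hx.1, hx.2.of_le (by omega)⟩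

theorem InDom.add : ∀ {j : ℕ} {x y : H}, InDom S j x → InDom S j y → InDom S j (x + y)
  | 0, _, _, _, _ => trivial
  | _ + 1, _, _, hx, hy => ⟨S.domain.add_mem hx.1 hy.1, by
      rw [ev_add hx.1 hy.1]; exact hx.2.add hy.2⟩

theorem InDom.sub : ∀ {j : ℕ} {x y : H}, InDom S j x → InDom S j y → InDom S j (x - y)
  | 0, _, _, _, _ => trivial
  | _ + 1, _, _, hx, hy => ⟨S.domain.sub_mem hx.1 hy.1, by
      rw [ev_sub hx.1 hy.1]; exact hx.2.sub hy.2⟩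

theorem InDom.smul (c : ℂ) : ∀ {j : ℕ} {x : H}, InDom S j x → InDom S j (c • x)
  | 0, _, _ => trivial
  | _ + 1, _, hx => ⟨S.domain.smul_mem c hx.1, by
      rw [ev_smul c hx.1]; exact hx.2.smul c⟩

theorem iterate_ev_add : ∀ {j : ℕ} {x y : H}, InDom S j x → InDom S j y →
    (ev S)^[j] (x + y) = (ev S)^[j] x + (ev S)^[j] y
  | 0, _, _, _, _ => rfl
  | j + 1, x, y, hx, hy => by
    simp only [Function.iterate_succ_apply]
    rw [ev_add hx.1 hy.1, iterate_ev_add hx.2 hy.2]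

theorem iterate_ev_sub : ∀ {j : ℕ} {x y : H}, InDom S j x → InDom S j y →
    (ev S)^[j] (x - y) = (ev S)^[j] x - (ev S)^[j] y
  | 0, _, _, _, _ => rfl
  | j + 1, x, y, hx, hy => by
    simp only [Function.iterate_succ_apply]
    rw [ev_sub hx.1 hy.1, iterate_ev_sub hx.2 hy.2]

theorem iterate_ev_smul (c : ℂ) : ∀ {j : ℕ} {x : H}, InDom S j x →
    (ev S)^[j] (c • x) = c • (ev S)^[j] x
  | 0, _, _ => rfl
  | j + 1, x, hx => by
    simp only [Function.iterate_succ_apply]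
    rw [ev_smul c hx.1, iterate_ev_smul c hx.2]

/-- `u : s → D(S^j)` is continuous for the graph norm of `S^j`. -/
def CDOn (S : H →ₗ.[ℂ] H) (s : Set ℝ) : ℕ → (ℝ → H) → Prop
  | 0, u => ContinuousOn u s
  | j + 1, u => ContinuousOn u s ∧ (∀ t ∈ s, u t ∈ S.domain) ∧ CDOn S s j fun t => ev S (u t)

variable {s : Set ℝ}

theorem CDOn.continuousOn : ∀ {j : ℕ} {u : ℝ → H}, CDOn S s j u → ContinuousOn u s
  | 0, _, h => h
  | _ + 1, _, h => h.1

theorem CDOn.congr : ∀ {j : ℕ} {u v : ℝ → H}, CDOn S s j u → EqOn v u s → CDOn S s j v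
  | 0, _, _, h, e => ContinuousOn.congr h e
  | _ + 1, _, _, h, e => ⟨h.1.congr e, fun t ht => by rw [e ht]; exact h.2.1 t ht,
      h.2.2.congr fun t ht => by simp only [e ht]⟩

theorem CDOn.of_le : ∀ {i j : ℕ} {u : ℝ → H}, CDOn S s j u → i ≤ j → CDOn S s i u
  | 0, _, _, hu, _ => hu.continuousOn
  | _ + 1, 0, _, _, h => absurd h (by omega)
  | _ + 1, _ + 1, _, hu, h => ⟨hu.1, hu.2.1, hu.2.2.of_le (by omega)⟩

theorem CDOn.inDom : ∀ {j : ℕ} {u : ℝ → H}, CDOn S s j u → ∀ t ∈ s, InDom S j (u t)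
  | 0, _, _, _, _ => trivial
  | _ + 1, _, hu, t, ht => ⟨hu.2.1 t ht, hu.2.2.inDom t ht⟩

theorem CDOn.iterate : ∀ {i j : ℕ} {u : ℝ → H}, CDOn S s j u → i ≤ j →
    ContinuousOn (fun t => (ev S)^[i] (u t)) s
  | 0, _, _, hu, _ => hu.continuousOn
  | _ + 1, 0, _, _, h => absurd h (by omega)
  | _ + 1, _ + 1, _, hu, h => hu.2.2.iterate (by omega)

theorem CDOn.of_iterate : ∀ {j : ℕ} {u : ℝ → H}, (∀ t ∈ s, InDom S j (u t)) →
    (∀ i ≤ j, ContinuousOn (fun t => (ev S)^[i] (u t)) s) → CDOn S s j u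
  | 0, _, _, h => h 0 le_rfl
  | _ + 1, _, hd, h => ⟨h 0 (by omega), fun t ht => (hd t ht).1,
      CDOn.of_iterate (fun t ht => (hd t ht).2) fun i hi => h (i + 1) (by omega)⟩

theorem CDOn.add : ∀ {j : ℕ} {u v : ℝ → H}, CDOn S s j u → CDOn S s j v →
    CDOn S s j fun t => u t + v t
  | 0, _, _, hu, hv => ContinuousOn.add hu hv
  | _ + 1, _, _, hu, hv => ⟨hu.1.add hv.1, fun t ht => S.domain.add_mem (hu.2.1 t ht) (hv.2.1 t ht),
      (hu.2.2.add hv.2.2).congr fun t ht => ev_add (hu.2.1 t ht) (hv.2.1 t ht)⟩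

theorem CDOn.sub : ∀ {j : ℕ} {u v : ℝ → H}, CDOn S s j u → CDOn S s j v →
    CDOn S s j fun t => u t - v t
  | 0, _, _, hu, hv => ContinuousOn.sub hu hv
  | _ + 1, _, _, hu, hv => ⟨hu.1.sub hv.1, fun t ht => S.domain.sub_mem (hu.2.1 t ht) (hv.2.1 t ht),
      (hu.2.2.sub hv.2.2).congr fun t ht => ev_sub (hu.2.1 t ht) (hv.2.1 t ht)⟩

theorem CDOn.smul (c : ℂ) : ∀ {j : ℕ} {u : ℝ → H}, CDOn S s j u → CDOn S s j fun t => c • u t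
  | 0, _, hu => ContinuousOn.const_smul hu c
  | _ + 1, _, hu => ⟨hu.1.const_smul c, fun t ht => S.domain.smul_mem c (hu.2.1 t ht),
      (hu.2.2.smul c).congr fun t ht => ev_smul c (hu.2.1 t ht)⟩

theorem CDOn.const : ∀ {j : ℕ} {a : H}, InDom S j a → CDOn S s j fun _ => a
  | 0, _, _ => continuousOn_const
  | _ + 1, _, h => ⟨continuousOn_const, fun _ _ => h.1, CDOn.const h.2⟩

theorem CDOn.comp {s' : Set ℝ} {φ : ℝ → ℝ} (hφ : ContinuousOn φ s') (hm : MapsTo φ s' s) :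
    ∀ {j : ℕ} {u : ℝ → H}, CDOn S s j u → CDOn S s' j fun t => u (φ t)
  | 0, _, hu => ContinuousOn.comp hu hφ hm
  | _ + 1, _, hu => ⟨hu.1.comp hφ hm, fun _ ht => hu.2.1 _ (hm ht), hu.2.2.comp hφ hm⟩

/-- U is only strongly continuous in t; joint continuity comes from isometry, which bounds
‖U(r)(u(r) - u(t))‖ by ‖u(r) - u(t)‖. Commutation with S then lifts this to every power. -/
theorem CDOn.propagator {τ : ℂ} {U : ℝ → H →L[ℂ] H} (hU : IsPropagator S τ U) {φ : ℝ → ℝ}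
    (hφ : ContinuousOn φ s) :
    ∀ {j : ℕ} {u : ℝ → H}, CDOn S s j u → CDOn S s j fun t => U (φ t) (u t)
  | 0, u, hu => by
    intro t ht
    rw [ContinuousWithinAt, tendsto_iff_norm_sub_tendsto_zero]
    have h1 := tendsto_iff_norm_sub_tendsto_zero.1 ((ContinuousOn.continuousWithinAt hu ht))
    have h2 := tendsto_iff_norm_sub_tendsto_zero.1
      (((hU.cont (u t)).tendsto (φ t)).comp (hφ t ht))
    refine squeeze_zero (fun _ => norm_nonneg _) (fun r => ?_) ((h1.add h2).trans_eq (by simp))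
    have h3 : U (φ r) (u r) - U (φ t) (u t) =
        U (φ r) (u r - u t) + (U (φ r) (u t) - U (φ t) (u t)) := by
      rw [map_sub]; abel
    rw [h3]
    refine (norm_add_le _ _).trans ?_
    rw [hU.norm]
    rfl
  | _ + 1, u, hu => ⟨CDOn.propagator (j := 0) hU hφ hu.1,
      fun t ht => LinearPMap.mem_domain_of_mem_graph
        (hU.graph (φ t) _ _ (ev_mem_graph (hu.2.1 t ht))),
      (hu.2.2.propagator hU hφ).congr fun t ht => ev_eq
        (hU.graph (φ t) _ _ (ev_mem_graph (hu.2.1 t ht)))⟩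

theorem CDOn.intervalIntegrable {j : ℕ} {u : ℝ → H} (hu : CDOn S univ j u) (a b : ℝ) :
    IntervalIntegrable u volume a b :=
  (continuousOn_univ.1 hu.continuousOn).intervalIntegrable a b

variable [CompleteSpace H]

theorem inner_intervalIntegral {u : ℝ → H} {a b : ℝ} (hu : IntervalIntegrable u volume a b)
    (w : H) : inner ℂ w (∫ t in a..b, u t) = ∫ t in a..b, inner ℂ w (u t) :=
  ((innerSL ℂ w).intervalIntegral_comp_comm hu).symm

/-- A self-adjoint operator commutes with integration. -/
theorem integral_mem_graph (hS : IsSelfAdjoint S) {u u' : ℝ → H} {a b : ℝ}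
    (hu : IntervalIntegrable u volume a b) (hu' : IntervalIntegrable u' volume a b)
    (h : ∀ t ∈ uIcc a b, (u t, u' t) ∈ S.graph) :
    (∫ t in a..b, u t, ∫ t in a..b, u' t) ∈ S.graph := by
  refine mem_graph_of_inner hS fun x y hxy => ?_
  rw [inner_intervalIntegral hu, inner_intervalIntegral hu']
  exact intervalIntegral.integral_congr fun t ht => graph_inner hS hxy (h t ht)

theorem integral_ev_mem_graph (hS : IsSelfAdjoint S) {j : ℕ} {u : ℝ → H}
    (hu : CDOn S univ (j + 1) u) (a b : ℝ) :
    (∫ t in a..b, u t, ∫ t in a..b, ev S (u t)) ∈ S.graph :=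
  integral_mem_graph hS (hu.intervalIntegrable a b) (hu.2.2.intervalIntegrable a b)
    fun t _ => ev_mem_graph (hu.2.1 t trivial)

theorem CDOn.integral (hS : IsSelfAdjoint S) (a : ℝ) :
    ∀ {j : ℕ} {u : ℝ → H}, CDOn S univ j u → CDOn S univ j fun t => ∫ s in a..t, u s
  | 0, _, hu => (intervalIntegral.continuous_primitive (fun b c => hu.intervalIntegrable b c)
      a).continuousOn
  | _ + 1, _, hu => ⟨CDOn.integral (j := 0) hS a hu.1,
      fun t _ => LinearPMap.mem_domain_of_mem_graph (integral_ev_mem_graph hS hu a t),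
      (hu.2.2.integral hS a).congr fun t _ => ev_eq (integral_ev_mem_graph hS hu a t)⟩

end Powers

/-! ### Translation of the norms of D(A^{j/2}) into iterates of S -/

section HalfPowers

variable {H : Type*} [NormedAddCommGroup H] [InnerProductSpace ℂ H] [CompleteSpace H]
  {A : H →ₗ.[ℂ] H}

theorem mem_halfPow_domain : ∀ {j : ℕ} {x : H},
    x ∈ (halfPow A j).domain ↔ InDom (sqrtOp A) j x
  | 0, _ => ⟨fun _ => trivial, fun _ => Submodule.mem_top⟩
  | j + 1, x => by
    change (∃ hx : x ∈ (sqrtOp A).domain, sqrtOp A ⟨x, hx⟩ ∈ (halfPow A j).domain) ↔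
      x ∈ (sqrtOp A).domain ∧ InDom (sqrtOp A) j (ev (sqrtOp A) x)
    constructor
    · rintro ⟨hx, h⟩
      refine ⟨hx, ?_⟩
      rw [ev, dif_pos hx]
      exact mem_halfPow_domain.1 h
    · rintro ⟨hx, h⟩
      refine ⟨hx, ?_⟩
      rw [ev, dif_pos hx] at h
      exact mem_halfPow_domain.2 h

theorem ev_halfPow : ∀ {j : ℕ} {x : H}, InDom (sqrtOp A) j x →
    ev (halfPow A j) x = (ev (sqrtOp A))^[j] x
  | 0, x, _ => by
    have h : x ∈ (halfPow A 0).domain := Submodule.mem_top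
    rw [ev, dif_pos h]
    rfl
  | j + 1, x, h => by
    rw [Function.iterate_succ_apply, ← ev_halfPow h.2]
    refine ev_eq (mem_opMul_graph.2 ⟨_, ev_mem_graph h.1, ev_mem_graph (mem_halfPow_domain.2 h.2)⟩)

theorem domNorm_eq {j : ℕ} {x : H} (h : InDom (sqrtOp A) j x) :
    domNorm A j x = √(∑ i ∈ Finset.range (j + 1), ‖(ev (sqrtOp A))^[i] x‖ ^ 2) := by
  rw [domNorm]
  congr 1
  refine Finset.sum_congr rfl fun i hi => ?_
  rw [ev_halfPow (h.of_le (by rw [Finset.mem_range] at hi; omega))]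

theorem iterate_le_domNorm {i j : ℕ} {x : H} (h : InDom (sqrtOp A) j x) (hi : i ≤ j) :
    ‖(ev (sqrtOp A))^[i] x‖ ≤ domNorm A j x := by
  rw [domNorm_eq h]
  refine Real.le_sqrt_of_sq_le ?_
  exact Finset.single_le_sum (f := fun i => ‖(ev (sqrtOp A))^[i] x‖ ^ 2)
    (fun _ _ => sq_nonneg _) (Finset.mem_range.2 (by omega))

theorem domNorm_le {j : ℕ} {x : H} {K : ℝ} (hK : 0 ≤ K) (h : InDom (sqrtOp A) j x)
    (hi : ∀ i ≤ j, ‖(ev (sqrtOp A))^[i] x‖ ≤ K) : domNorm A j x ≤ (j + 1) * K := by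
  rw [domNorm_eq h]
  refine Real.sqrt_le_iff.2 ⟨by positivity, ?_⟩
  have h1 : ∑ i ∈ Finset.range (j + 1), ‖(ev (sqrtOp A))^[i] x‖ ^ 2 ≤
      ∑ _i ∈ Finset.range (j + 1), K ^ 2 := by
    refine Finset.sum_le_sum fun i hi' => ?_
    have := hi i (by rw [Finset.mem_range] at hi'; omega)
    gcongr
  rw [Finset.sum_const, Finset.card_range, nsmul_eq_mul] at h1
  push_cast at h1
  have h2 : (0 : ℝ) ≤ j := by positivity
  have h3 := mul_nonneg (mul_nonneg h2 (by linarith : (0 : ℝ) ≤ j + 1)) (sq_nonneg K)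
  nlinarith

theorem domNorm_nonneg (A : H →ₗ.[ℂ] H) (j : ℕ) (x : H) : 0 ≤ domNorm A j x := Real.sqrt_nonneg _

/-- On D(S^j) the norm is the ℓ² sum of the norms of the S^i x, and the S^i are additive there, so
continuity in this norm is continuity of each S^i u separately. -/
theorem contIntoDom_iff {j : ℕ} {T : ℝ} {u : ℝ → H} :
    ContIntoDom A j T u ↔ CDOn (sqrtOp A) (Icc 0 T) j u := by
  constructor
  · rintro ⟨h1, h2⟩
    simp only [mem_halfPow_domain] at h1
    refine CDOn.of_iterate h1 fun i hi t ht => ?_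
    rw [ContinuousWithinAt, tendsto_iff_norm_sub_tendsto_zero]
    refine squeeze_zero' (Eventually.of_forall fun _ => norm_nonneg _) ?_ (h2 t ht)
    filter_upwards [self_mem_nhdsWithin] with r hr
    rw [← iterate_ev_sub ((h1 r hr).of_le hi) ((h1 t ht).of_le hi)]
    exact iterate_le_domNorm ((h1 r hr).sub (h1 t ht)) hi
  · intro h
    refine ⟨fun t ht => mem_halfPow_domain.2 (h.inDom t ht), fun t ht => ?_⟩
    have h1 : Tendsto (fun r => √(∑ i ∈ Finset.range (j + 1),
        ‖(ev (sqrtOp A))^[i] (u r) - (ev (sqrtOp A))^[i] (u t)‖ ^ 2)) (𝓝[Icc 0 T] t) (𝓝 0) := by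
      have h2 : Tendsto (fun r => ∑ i ∈ Finset.range (j + 1),
          ‖(ev (sqrtOp A))^[i] (u r) - (ev (sqrtOp A))^[i] (u t)‖ ^ 2) (𝓝[Icc 0 T] t)
          (𝓝 (∑ i ∈ Finset.range (j + 1), 0)) := by
        refine tendsto_finsetSum _ fun i hi => ?_
        have h3 := h.iterate (i := i) (by rw [Finset.mem_range] at hi; omega) t ht
        have h4 := (tendsto_iff_norm_sub_tendsto_zero.1 h3).pow 2
        simpa using h4
      simpa using h2.sqrt
    refine h1.congr' ?_
    filter_upwards [self_mem_nhdsWithin] with r hr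
    rw [domNorm_eq ((h.inDom r hr).sub (h.inDom t ht))]
    congr 1
    refine Finset.sum_congr rfl fun i hi => ?_
    have hi' : i ≤ j := by rw [Finset.mem_range] at hi; omega
    rw [iterate_ev_sub ((h.inDom r hr).of_le hi') ((h.inDom t ht).of_le hi')]

/-- By compactness of `[0,T]`, the supremum `supDomNorm` is a genuine upper bound. -/
theorem domNorm_le_supDomNorm {j : ℕ} {T : ℝ} {u : ℝ → H}
    (h : CDOn (sqrtOp A) (Icc 0 T) j u) {t : ℝ} (ht : t ∈ Icc 0 T) :
    domNorm A j (u t) ≤ supDomNorm A j T u := by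
  have h1 : ContinuousOn (fun t => domNorm A j (u t)) (Icc 0 T) := by
    have h2 : ContinuousOn (fun t => √(∑ i ∈ Finset.range (j + 1),
        ‖(ev (sqrtOp A))^[i] (u t)‖ ^ 2)) (Icc 0 T) := by
      refine ContinuousOn.sqrt (continuousOn_finsetSum _ fun i hi => ?_)
      exact (h.iterate (by rw [Finset.mem_range] at hi; omega)).norm.pow 2
    exact h2.congr fun t ht => domNorm_eq (h.inDom t ht)
  obtain ⟨K, hK⟩ := isCompact_Icc.bddAbove_image h1
  refine le_ciSup (f := fun t : Icc (0 : ℝ) T => domNorm A j (u t)) ⟨K, ?_⟩ ⟨t, ht⟩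
  rintro _ ⟨r, rfl⟩
  exact hK ⟨r, r.2, rfl⟩

theorem supDomNorm_le {j : ℕ} {T : ℝ} (hT : 0 ≤ T) {u : ℝ → H} {K : ℝ}
    (h : ∀ t ∈ Icc 0 T, domNorm A j (u t) ≤ K) : supDomNorm A j T u ≤ K := by
  have : Nonempty (Icc (0 : ℝ) T) := ⟨⟨0, left_mem_Icc.2 hT⟩⟩
  exact ciSup_le fun t => h t t.2

end HalfPowers

/-! ### Duhamel's formula and the solution on the whole line -/

section Duhamel

variable {H : Type*} [NormedAddCommGroup H] [InnerProductSpace ℂ H]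
  {S : H →ₗ.[ℂ] H}

/-- Duhamel's formula for the mild solution of `z' = τ S z + F`, `z 0 = a`. -/
def duhamel (U : ℝ → H →L[ℂ] H) (a : H) (F : ℝ → H) (t : ℝ) : H :=
  U t (a + ∫ s in (0 : ℝ)..t, U (-s) (F s))

variable {τ : ℂ} {U : ℝ → H →L[ℂ] H}

theorem CDOn.duhamel_integrand (hU : IsPropagator S τ U) {j : ℕ} {F : ℝ → H}
    (hF : CDOn S univ j F) : CDOn S univ j fun t => U (-t) (F t) :=
  hF.propagator hU continuous_neg.continuousOn

theorem duhamel_zero (hU : IsPropagator S τ U) (a : H) (F : ℝ → H) : duhamel U a F 0 = a := by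
  simp [duhamel, hU.zero]

theorem norm_duhamel_le (hU : IsPropagator S τ U) {a : H} {F : ℝ → H} {K : ℝ}
    (hK : ∀ s, ‖F s‖ ≤ K) (t : ℝ) : ‖duhamel U a F t‖ ≤ ‖a‖ + K * |t| := by
  rw [duhamel, hU.norm]
  refine (norm_add_le _ _).trans (add_le_add_right ?_ _)
  have := intervalIntegral.norm_integral_le_of_norm_le_const (a := 0) (b := t)
    (f := fun s => U (-s) (F s)) (C := K) fun s _ => by rw [hU.norm]; exact hK s
  simpa using this

variable [CompleteSpace H]

theorem CDOn.duhamel (hS : IsSelfAdjoint S) (hU : IsPropagator S τ U) {j : ℕ} {a : H} {F : ℝ → H}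
    (ha : InDom S j a) (hF : CDOn S univ j F) : CDOn S univ j (duhamel U a F) :=
  ((CDOn.const ha).add ((hF.duhamel_integrand hU).integral hS 0)).propagator hU continuousOn_id

/-- S commutes with the group and, being closed, with the integral. A bound for S^i of the mild
solution thus reduces to the plain norm bound for transformed data. -/
theorem ev_duhamel (hS : IsSelfAdjoint S) (hU : IsPropagator S τ U) {j : ℕ} {a : H} {F : ℝ → H}
    (ha : InDom S (j + 1) a) (hF : CDOn S univ (j + 1) F) (t : ℝ) :
    ev S (duhamel U a F t) = duhamel U (ev S a) (fun s => ev S (F s)) t := by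
  have h := integral_mem_graph hS ((hF.duhamel_integrand hU).intervalIntegrable 0 t)
    ((hF.2.2.duhamel_integrand hU).intervalIntegrable 0 t)
    fun s _ => hU.graph _ _ _ (ev_mem_graph (hF.2.1 s trivial))
  exact ev_eq (hU.graph t _ _ (S.graph.add_mem (ev_mem_graph ha.1) h))

theorem norm_iterate_duhamel_le (hS : IsSelfAdjoint S) (hU : IsPropagator S τ U) {K : ℝ} (t : ℝ) :
    ∀ {i j : ℕ} {a : H} {F : ℝ → H}, i ≤ j → InDom S j a → CDOn S univ j F →
      (∀ s, ‖(ev S)^[i] (F s)‖ ≤ K) →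
      ‖(ev S)^[i] (duhamel U a F t)‖ ≤ ‖(ev S)^[i] a‖ + K * |t|
  | 0, _, _, _, _, _, _, hK => norm_duhamel_le hU hK t
  | _ + 1, 0, _, _, h, _, _, _ => absurd h (by omega)
  | i + 1, j + 1, a, F, h, ha, hF, hK => by
    simp only [Function.iterate_succ_apply] at hK ⊢
    rw [ev_duhamel hS hU ha hF]
    exact norm_iterate_duhamel_le hS hU t (by omega) ha.2 hF.2.2 hK

/-- Duhamel's formula solves the equation weakly. -/
theorem hasDerivAt_inner_duhamel (hU : IsPropagator S τ U) (hτ : conj τ = -τ) {a : H}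
    {F : ℝ → H} (hF : Continuous F) {w w' : H} (hw : (w, w') ∈ S.graph) (t : ℝ) :
    HasDerivAt (fun t => inner ℂ w (duhamel U a F t))
      (inner ℂ w (F t) + τ * inner ℂ w' (duhamel U a F t)) t := by
  have hc : Continuous fun s => U (-s) (F s) := continuousOn_univ.1
    (CDOn.duhamel_integrand (j := 0) hU hF.continuousOn)
  have h1 : HasDerivAt (fun t => a + ∫ s in (0 : ℝ)..t, U (-s) (F s)) (U (-t) (F t)) t :=
    (intervalIntegral.integral_hasDerivAt_right (hc.intervalIntegrable 0 t)
      (hc.stronglyMeasurableAtFilter _ _) hc.continuousAt).const_add a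
  -- Duhamel's expression need not be differentiable, but U(t) can be moved to the test vector as
  -- U(-t)w, which is differentiable because w ∈ D(S); the product rule does the rest.
  have h2 := hU.neg.deriv t w w' hw
  have h3 := h2.inner ℂ h1
  have hadj : ∀ s (x y : H), inner ℂ (U (-s) x) y = inner ℂ x (U s y) := fun s x y => by
    rw [hU.adj, neg_neg]
  simp only [inner_smul_left, hadj, map_neg, hτ, neg_neg] at h3
  have h4 : U t (U (-t) (F t)) = F t := hU.inv t _
  rw [h4] at h3
  exact h3

/-- Existence for `v'' + S² v = F` on the whole line. -/
theorem exists_global_solution (hS : IsSelfAdjoint S) (hp : IsNonneg S) {m : ℕ} {F : ℝ → H}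
    {g h : H} (hF : CDOn S univ m F) (hg : InDom S (m + 1) g) (hh : InDom S m h) :
    ∃ v p : ℝ → H, CDOn S univ (m + 1) v ∧ CDOn S univ m p ∧ (∀ t, HasDerivAt v (p t) t) ∧
      v 0 = g ∧ p 0 = h ∧
      (∀ w w', (w, w') ∈ S.graph → ∀ t, HasDerivAt (fun t => inner ℂ w (p t))
        (inner ℂ w (F t) - inner ℂ w' (ev S (v t))) t) ∧
      ∀ K, (∀ i ≤ m, ∀ s, ‖(ev S)^[i] (F s)‖ ≤ K) → (∀ i ≤ m, ‖(ev S)^[i] h‖ ≤ K) →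
        (∀ i ≤ m + 1, ‖(ev S)^[i] g‖ ≤ K) → ∀ t, ∀ i ≤ m,
          ‖(ev S)^[i] (p t)‖ ≤ (2 + |t|) * K ∧ ‖(ev S)^[i + 1] (v t)‖ ≤ (2 + |t|) * K := by
  obtain ⟨U, hU⟩ := exists_isPropagator hS hp
  have hg' : InDom S m (Complex.I • ev S g) := hg.2.smul _
  have ha : InDom S m (h + Complex.I • ev S g) := hh.add hg'
  have hb : InDom S m (h - Complex.I • ev S g) := hh.sub hg'
  have hF' : Continuous F := continuousOn_univ.1 hF.continuousOn
  -- y stands for v' + iSv and z for v' - iSv; below, p = (y + z)/2 is to be v' and q = (y - z)/(2i)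
  -- is to be Sv.
  set y := duhamel U (h + Complex.I • ev S g) F with hy
  set z := duhamel (fun t => U (-t)) (h - Complex.I • ev S g) F with hz
  have cy : CDOn S univ m y := CDOn.duhamel hS hU ha hF
  have cz : CDOn S univ m z := CDOn.duhamel hS hU.neg hb hF
  let p : ℝ → H := fun t => (1 / 2 : ℂ) • (y t + z t)
  let q : ℝ → H := fun t => (-Complex.I / 2 : ℂ) • (y t - z t)
  have cp : CDOn S univ m p := (cy.add cz).smul _
  have cq : CDOn S univ m q := (cy.sub cz).smul _
  have hp' : Continuous p := continuousOn_univ.1 cp.continuousOn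
  have hy0 : y 0 = h + Complex.I • ev S g := duhamel_zero hU _ _
  have hz0 : z 0 = h - Complex.I • ev S g := duhamel_zero hU.neg _ _
  have hp0 : p 0 = h := by
    simp only [p, hy0, hz0]; module
  have hq0 : q 0 = ev S g := by
    simp only [q, hy0, hz0]
    rw [add_sub_sub_cancel, ← two_smul ℂ (Complex.I • ev S g), smul_smul, smul_smul]
    have : -Complex.I / 2 * 2 * Complex.I = 1 := by
      linear_combination -Complex.I_sq
    rw [this, one_smul]
  let v : ℝ → H := fun t => g + ∫ s in (0 : ℝ)..t, p s
  have hv : ∀ t, HasDerivAt v (p t) t := fun t =>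
    (intervalIntegral.integral_hasDerivAt_right (hp'.intervalIntegrable 0 t)
      (hp'.stronglyMeasurableAtFilter _ _) hp'.continuousAt).const_add g
  have hv0 : v 0 = g := by simp [v]
  have hyd := fun w w' (hw : (w, w') ∈ S.graph) t =>
    hasDerivAt_inner_duhamel hU (by simp) (a := h + Complex.I • ev S g) hF' hw t
  have hzd := fun w w' (hw : (w, w') ∈ S.graph) t =>
    hasDerivAt_inner_duhamel hU.neg (by simp) (a := h - Complex.I • ev S g) hF' hw t
  simp only [← hy, ← hz] at hyd hzd
  have hpd : ∀ w w', (w, w') ∈ S.graph → ∀ t, HasDerivAt (fun t => inner ℂ w (p t))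
      (inner ℂ w (F t) - inner ℂ w' (q t)) t := by
    intro w w' hw t
    have h1 := ((hyd w w' hw t).add (hzd w w' hw t)).const_mul (1 / 2 : ℂ)
    refine (h1.congr_of_eventuallyEq (Eventually.of_forall fun t => ?_)).congr_deriv ?_
    · simp only [p, inner_smul_right, inner_add_right, Pi.add_apply]
    · simp only [q, inner_smul_right, inner_sub_right]
      ring
  have hqd : ∀ w w', (w, w') ∈ S.graph → ∀ t, HasDerivAt (fun t => inner ℂ w (q t))
      (inner ℂ w' (p t)) t := by
    intro w w' hw t
    have h1 := ((hyd w w' hw t).sub (hzd w w' hw t)).const_mul (-Complex.I / 2 : ℂ)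
    refine (h1.congr_of_eventuallyEq (Eventually.of_forall fun t => ?_)).congr_deriv ?_
    · simp only [q, inner_smul_right, inner_sub_right, Pi.sub_apply]
    · simp only [p, inner_smul_right, inner_add_right]
      linear_combination (-1 / 2 * inner ℂ w' (y t) - 1 / 2 * inner ℂ w' (z t)) * Complex.I_sq
  -- For w ∈ D(S), ⟨Sw, v⟩ and ⟨w, q⟩ both have derivative ⟨Sw, p⟩ and agree at time 0.
  -- Self-adjointness turns this into v ∈ D(S), Sv = q, the extra power of S that v has over p.
  have hvq : ∀ t, (v t, q t) ∈ S.graph := by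
    intro t
    refine mem_graph_of_inner hS fun w w' hw => ?_
    have h1 : ∀ t, HasDerivAt (fun t => inner ℂ w' (v t) - inner ℂ w (q t)) 0 t := by
      intro t
      have h2 := ((innerSL ℂ w').restrictScalars ℝ).hasFDerivAt.comp_hasDerivAt t (hv t)
      have h3 := HasDerivAt.fun_sub h2 (hqd w w' hw t)
      simpa using h3
    have h2 := is_const_of_deriv_eq_zero (fun t => (h1 t).differentiableAt) (fun t => (h1 t).deriv)
      t 0
    simp only [hv0, hq0] at h2
    rw [graph_inner hS hw (ev_mem_graph hg.1), sub_self, sub_eq_zero] at h2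
    exact h2
  have hev : ∀ t, ev S (v t) = q t := fun t => ev_eq (hvq t)
  refine ⟨v, p, ⟨?_, ?_, ?_⟩, cp, hv, hv0, hp0, ?_, ?_⟩
  · exact (continuous_iff_continuousAt.2 fun t => (hv t).continuousAt).continuousOn
  · exact fun t _ => LinearPMap.mem_domain_of_mem_graph (hvq t)
  · exact cq.congr fun t _ => hev t
  · intro w w' hw t
    rw [hev]
    exact hpd w w' hw t
  · intro K hKF hKh hKg t i hi
    have e1 : ‖Complex.I • (ev S)^[i] (ev S g)‖ ≤ K := by
      rw [norm_smul, Complex.norm_I, one_mul]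
      exact hKg (i + 1) (by omega)
    -- One K each for h and Sg in the initial value, and K|t| for the source.
    have b1 : ‖(ev S)^[i] (y t)‖ ≤ 2 * K + K * |t| := by
      refine (norm_iterate_duhamel_le hS hU t hi ha hF (hKF i hi)).trans (add_le_add_left ?_ _)
      rw [iterate_ev_add (hh.of_le hi) (hg'.of_le hi), iterate_ev_smul _ (hg.2.of_le hi)]
      exact (norm_add_le _ _).trans (by linarith [hKh i hi])
    have b2 : ‖(ev S)^[i] (z t)‖ ≤ 2 * K + K * |t| := by
      refine (norm_iterate_duhamel_le hS hU.neg t hi hb hF (hKF i hi)).trans (add_le_add_left ?_ _)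
      rw [iterate_ev_sub (hh.of_le hi) (hg'.of_le hi), iterate_ev_smul _ (hg.2.of_le hi)]
      exact (norm_sub_le _ _).trans (by linarith [hKh i hi])
    have iy := (cy.inDom t trivial).of_le hi
    have iz := (cz.inDom t trivial).of_le hi
    constructor
    · simp only [p]
      rw [iterate_ev_smul _ (iy.add iz), iterate_ev_add iy iz, norm_smul]
      have := norm_add_le ((ev S)^[i] (y t)) ((ev S)^[i] (z t))
      norm_num
      linarith
    · rw [Function.iterate_succ_apply, hev]
      simp only [q]
      rw [iterate_ev_smul _ (iy.sub iz), iterate_ev_sub iy iz, norm_smul]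
      have := norm_sub_le ((ev S)^[i] (y t)) ((ev S)^[i] (z t))
      norm_num
      linarith

/-- If `S v ∈ D(S)` the weak equation is a strong one. -/
theorem hasDerivAt_of_weak (hS : IsSelfAdjoint S) {p k : ℝ → H} (hk : Continuous k)
    (h : ∀ w w', (w, w') ∈ S.graph → ∀ t, HasDerivAt (fun t => inner ℂ w (p t))
      (inner ℂ w (k t)) t) (t : ℝ) : HasDerivAt p (k t) t := by
  have h1 : ∀ t, HasDerivAt (fun t => p 0 + ∫ s in (0 : ℝ)..t, k s) (k t) t := fun t =>
    (intervalIntegral.integral_hasDerivAt_right (hk.intervalIntegrable 0 t)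
      (hk.stronglyMeasurableAtFilter _ _) hk.continuousAt).const_add (p 0)
  -- Both sides have the same weak derivative against D(S), and D(S) is dense.
  have h2 : ∀ t, p t = p 0 + ∫ s in (0 : ℝ)..t, k s := by
    intro t
    refine eq_of_inner_graph hS fun w w' hw => ?_
    have h3 : ∀ t, HasDerivAt (fun t => inner ℂ w (p t) -
        inner ℂ w (p 0 + ∫ s in (0 : ℝ)..t, k s)) 0 t := by
      intro t
      have h4 := ((innerSL ℂ w).restrictScalars ℝ).hasFDerivAt.comp_hasDerivAt t (h1 t)
      have h5 := HasDerivAt.fun_sub (h w w' hw t) h4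
      exact h5.congr_deriv (by simp)
    have h6 := is_const_of_deriv_eq_zero (fun t => (h3 t).differentiableAt)
      (fun t => (h3 t).deriv) t 0
    simpa [sub_eq_zero] using h6
  exact (h1 t).congr_of_eventuallyEq (Eventually.of_forall h2)

end Duhamel

/-! ### Calculus on [0,T] with one-sided derivatives at the end points -/

section Interval

variable {E : Type*} [NormedAddCommGroup E] [NormedSpace ℝ E] {T : ℝ}

theorem eq_of_hasDerivWithinAt {u v u' : ℝ → E}
    (hu : ∀ t ∈ Icc 0 T, HasDerivWithinAt u (u' t) (Icc 0 T) t)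
    (hv : ∀ t ∈ Icc 0 T, HasDerivWithinAt v (u' t) (Icc 0 T) t) (h0 : u 0 = v 0) :
    EqOn u v (Icc 0 T) := by
  have h : ∀ {w : ℝ → E}, (∀ t ∈ Icc 0 T, HasDerivWithinAt w (u' t) (Icc 0 T) t) →
      ∀ t ∈ Ico 0 T, HasDerivWithinAt w (u' t) (Ici t) t := fun hw t ht =>
    (hw t ⟨ht.1, ht.2.le⟩).mono_of_mem_nhdsWithin (Icc_mem_nhdsGE_of_mem ht)
  exact fun t ht => eq_of_has_deriv_right_eq (h hu) (h hv)
    (fun t ht => (hu t ht).continuousWithinAt) (fun t ht => (hv t ht).continuousWithinAt) h0 t ht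

/-- The projection of the real line onto `[0,T]`. -/
def clamp (T t : ℝ) : ℝ := max 0 (min T t)

theorem clamp_mem (hT : 0 ≤ T) (t : ℝ) : clamp T t ∈ Icc 0 T :=
  ⟨le_max_left _ _, max_le hT (min_le_left _ _)⟩

theorem clamp_eq {t : ℝ} (ht : t ∈ Icc 0 T) : clamp T t = t := by
  rw [clamp, min_eq_right ht.2, max_eq_right ht.1]

theorem continuous_clamp : Continuous (clamp T) := by unfold clamp; fun_prop

theorem hasDerivWithinAt_integral_clamp [CompleteSpace E] {u : ℝ → E}
    (hT : 0 ≤ T) (hu : ContinuousOn u (Icc 0 T)) (c : E) {t : ℝ} (ht : t ∈ Icc 0 T) :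
    HasDerivWithinAt (fun t => c + ∫ s in (0 : ℝ)..t, u (clamp T s)) (u t) (Icc 0 T) t := by
  have hc : Continuous fun s => u (clamp T s) := continuousOn_univ.1
    (hu.comp continuous_clamp.continuousOn fun t _ => clamp_mem hT t)
  have := ((intervalIntegral.integral_hasDerivAt_right (hc.intervalIntegrable 0 t)
      (hc.stronglyMeasurableAtFilter _ _) hc.continuousAt).const_add c).hasDerivWithinAt
      (s := Icc 0 T)
  rwa [clamp_eq ht] at this

theorem eq_add_integral_clamp [CompleteSpace E] {u u' : ℝ → E} (hT : 0 ≤ T)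
    (hu : ∀ t ∈ Icc 0 T, HasDerivWithinAt u (u' t) (Icc 0 T) t)
    (hu' : ContinuousOn u' (Icc 0 T)) :
    EqOn u (fun t => u 0 + ∫ s in (0 : ℝ)..t, u' (clamp T s)) (Icc 0 T) :=
  eq_of_hasDerivWithinAt hu (fun _ ht => hasDerivWithinAt_integral_clamp hT hu' _ ht) (by simp)

end Interval

/-! ### Joint regularity in time and in powers of S -/

section Regularity

variable {H : Type*} [NormedAddCommGroup H] [InnerProductSpace ℂ H] {S : H →ₗ.[ℂ] H} {T : ℝ}

theorem CDOn.clamp (hT : 0 ≤ T) {j : ℕ} {u : ℝ → H} (hu : CDOn S (Icc 0 T) j u) :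
    CDOn S univ j fun t => u (clamp T t) :=
  hu.comp continuous_clamp.continuousOn fun t _ => clamp_mem hT t

theorem inner_hasDerivWithinAt {u : ℝ → H} {u' : H} {s : Set ℝ} {t : ℝ} (w : H)
    (h : HasDerivWithinAt u u' s t) :
    HasDerivWithinAt (fun t => inner ℂ w (u t)) (inner ℂ w u') s t :=
  ((innerSL ℂ w).restrictScalars ℝ).hasFDerivAt.comp_hasDerivWithinAt t h

variable [CompleteSpace H]

/-- Writing u as the integral of u' moves S under the integral sign; differentiating the resulting
primitive gives the claim. -/
theorem ev_hasDerivWithinAt (hT : 0 ≤ T) (hS : IsSelfAdjoint S) {u u' : ℝ → H}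
    (h : ∀ t ∈ Icc 0 T, HasDerivWithinAt u (u' t) (Icc 0 T) t) (hu : CDOn S (Icc 0 T) 1 u)
    (hu' : CDOn S (Icc 0 T) 1 u') :
    ∀ t ∈ Icc 0 T, HasDerivWithinAt (fun t => ev S (u t)) (ev S (u' t)) (Icc 0 T) t := by
  have h1 := eq_add_integral_clamp hT h hu'.continuousOn
  intro t ht
  have key : ∀ t ∈ Icc 0 T, ev S (u t) =
      ev S (u 0) + ∫ s in (0 : ℝ)..t, ev S (u' (HypReg.clamp T s)) := by
    intro t ht
    have h2 := integral_ev_mem_graph hS (j := 0) (hu'.clamp hT) 0 t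
    have h3 := S.graph.add_mem (ev_mem_graph (hu.2.1 0 ⟨le_rfl, hT⟩)) h2
    rw [h1 ht]
    exact ev_eq h3
  exact (hasDerivWithinAt_integral_clamp (u := fun t => ev S (u' t)) hT hu'.2.2 _ ht).congr key
    (key t ht)

/-- `∂_t^k u ∈ C⁰([0,T]; D(S^(j-k)))` for `k ≤ p`. -/
def TR (S : H →ₗ.[ℂ] H) (T : ℝ) (p j : ℕ) (u : ℝ → H) : Prop :=
  ContDiffOn ℝ p u (Icc 0 T) ∧ ∀ k ≤ p, CDOn S (Icc 0 T) (j - k) (dt k T u)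

theorem dt_congr {u v : ℝ → H} (h : EqOn u v (Icc 0 T)) (k : ℕ) :
    EqOn (dt k T u) (dt k T v) (Icc 0 T) :=
  iteratedDerivWithin_congr h

theorem dt_zero (u : ℝ → H) : dt 0 T u = u := iteratedDerivWithin_zero

theorem dt_succ (k : ℕ) (u : ℝ → H) : dt (k + 1) T u = dt k T (derivWithin u (Icc 0 T)) :=
  iteratedDerivWithin_succ'

theorem dt_succ_eqOn (hT : 0 < T) {u u' : ℝ → H}
    (h : ∀ t ∈ Icc 0 T, HasDerivWithinAt u (u' t) (Icc 0 T) t) (k : ℕ) :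
    EqOn (dt (k + 1) T u) (dt k T u') (Icc 0 T) := by
  rw [dt_succ]
  exact dt_congr (fun t ht => (h t ht).derivWithin (uniqueDiffOn_Icc hT t ht)) k

theorem TR.zero_iff {j : ℕ} {u : ℝ → H} : TR S T 0 j u ↔ CDOn S (Icc 0 T) j u := by
  constructor
  · intro h
    simpa [dt_zero] using h.2 0 le_rfl
  · intro h
    refine ⟨contDiffOn_zero.2 h.continuousOn, fun k hk => ?_⟩
    obtain rfl : k = 0 := by omega
    simpa [dt_zero] using h

theorem TR.cdOn {p j : ℕ} {u : ℝ → H} (h : TR S T p j u) : CDOn S (Icc 0 T) j u := by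
  simpa [dt_zero] using h.2 0 (Nat.zero_le _)

theorem TR.of_le {p j p' j' : ℕ} {u : ℝ → H} (h : TR S T p j u) (hp : p' ≤ p) (hj : j' ≤ j) :
    TR S T p' j' u :=
  ⟨h.1.of_le (by exact_mod_cast hp), fun k hk => (h.2 k (hk.trans hp)).of_le (by omega)⟩

theorem TR.succ (hT : 0 < T) {p j : ℕ} {u u' : ℝ → H} (hu : CDOn S (Icc 0 T) j u)
    (h : ∀ t ∈ Icc 0 T, HasDerivWithinAt u (u' t) (Icc 0 T) t) (h' : TR S T p (j - 1) u') :
    TR S T (p + 1) j u := by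
  constructor
  · push_cast
    rw [contDiffOn_succ_iff_derivWithin (uniqueDiffOn_Icc hT)]
    refine ⟨fun t ht => (h t ht).differentiableWithinAt, by simp, ?_⟩
    exact h'.1.congr fun t ht => (h t ht).derivWithin (uniqueDiffOn_Icc hT t ht)
  · rintro (_ | k) hk
    · simpa [dt_zero] using hu
    · refine ((h'.2 k (by omega)).of_le (by omega)).congr (dt_succ_eqOn hT h k)

theorem TR.hasDerivWithinAt {p j : ℕ} {u : ℝ → H} (h : TR S T (p + 1) j u) :
    ∀ t ∈ Icc 0 T, HasDerivWithinAt u (derivWithin u (Icc 0 T) t) (Icc 0 T) t :=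
  fun t ht => ((h.1.differentiableOn (by simp)) t ht).hasDerivWithinAt

theorem TR.derivWithin (hT : 0 < T) {p j : ℕ} {u : ℝ → H} (h : TR S T (p + 1) j u) :
    TR S T p (j - 1) (derivWithin u (Icc 0 T)) := by
  constructor
  · have := h.1
    push_cast at this
    rw [contDiffOn_succ_iff_derivWithin (uniqueDiffOn_Icc hT)] at this
    exact this.2.2
  · intro k hk
    rw [← dt_succ]
    exact (h.2 (k + 1) (by omega)).of_le (by omega)

theorem dt_sub (hT : 0 < T) {p : ℕ} {u v : ℝ → H} (hu : ContDiffOn ℝ p u (Icc 0 T))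
    (hv : ContDiffOn ℝ p v (Icc 0 T)) {k : ℕ} (hk : k ≤ p) :
    EqOn (dt k T fun t => u t - v t) (fun t => dt k T u t - dt k T v t) (Icc 0 T) :=
  fun t ht => iteratedDerivWithin_sub ht (uniqueDiffOn_Icc hT)
    ((hu.of_le (by exact_mod_cast hk)) t ht) ((hv.of_le (by exact_mod_cast hk)) t ht)

theorem TR.sub (hT : 0 < T) {p j : ℕ} {u v : ℝ → H} (hu : TR S T p j u) (hv : TR S T p j v) :
    TR S T p j fun t => u t - v t :=
  ⟨hu.1.sub hv.1, fun k hk => ((hu.2 k hk).sub (hv.2 k hk)).congr (dt_sub hT hu.1 hv.1 hk)⟩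

/-- `S` commutes with time derivatives. -/
theorem TR.ev (hT : 0 < T) (hS : IsSelfAdjoint S) : ∀ {p j : ℕ} {u : ℝ → H},
    TR S T p (j + 1) u → p ≤ j → TR S T p j (fun t => ev S (u t)) ∧
      ∀ k ≤ p, EqOn (dt k T fun t => ev S (u t)) (fun t => HypReg.ev S (dt k T u t)) (Icc 0 T)
  | 0, j, u, h, _ => by
    refine ⟨TR.zero_iff.2 h.cdOn.2.2, fun k hk => ?_⟩
    obtain rfl : k = 0 := by omega
    simp only [dt_zero]
    exact fun _ _ => rfl
  | p + 1, 0, _, _, h => absurd h (by omega)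
  | p + 1, j + 1, u, h, hpj => by
    have h1 : TR S T p (j + 1) (_root_.derivWithin u (Icc 0 T)) := h.derivWithin hT
    obtain ⟨h2, h3⟩ := TR.ev hT hS h1 (by omega)
    have h4 := ev_hasDerivWithinAt hT.le hS h.hasDerivWithinAt (h.cdOn.of_le (by omega))
      (h1.cdOn.of_le (by omega))
    refine ⟨TR.succ hT h.cdOn.2.2 h4 h2, ?_⟩
    rintro (_ | k) hk
    · simp only [dt_zero]
      exact fun _ _ => rfl
    · intro t ht
      rw [dt_succ_eqOn hT h4 k ht, h3 k (by omega) ht, dt_succ]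

theorem timeRegular_iff {A : H →ₗ.[ℂ] H} {p : ℕ} {u : ℝ → H} :
    TimeRegular A p T u ↔ TR (sqrtOp A) T p p u := by
  simp only [TimeRegular, TR, contIntoDom_iff]

/-- The bootstrap for `v'' = f - S² v`. -/
theorem TR.bootstrap (hT : 0 < T) (hS : IsSelfAdjoint S) {m : ℕ} {f v p : ℝ → H}
    (hf : TR S T m m f) (hv : CDOn S (Icc 0 T) (m + 1) v) (hp : CDOn S (Icc 0 T) m p)
    (hvp : ∀ t ∈ Icc 0 T, HasDerivWithinAt v (p t) (Icc 0 T) t)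
    (hpf : 1 ≤ m → ∀ t ∈ Icc 0 T, HasDerivWithinAt p (f t - HypReg.ev S (HypReg.ev S (v t)))
      (Icc 0 T) t) :
    ∀ q ≤ m, TR S T (q + 1) (m + 1) v
  | 0, _ => TR.succ hT hv hvp (TR.zero_iff.2 hp)
  | q + 1, hq => by
    obtain ⟨m, rfl⟩ : ∃ n, m = n + 1 := ⟨m - 1, by omega⟩
    -- Each round gains one time derivative at fixed total order. Only q derivatives of v are kept,
    -- so that S may be applied twice; then S²v has q of them, p has q + 1 and v has q + 2.
    have h1 : TR S T q (m + 2) v :=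
      (TR.bootstrap hT hS hf hv hp hvp hpf q (by omega)).of_le (by omega) le_rfl
    have h2 := (h1.ev hT hS (by omega)).1
    have h3 := (h2.ev hT hS (by omega)).1
    have h4 := (hf.of_le (by omega : q ≤ m + 1) (by omega : m ≤ m + 1)).sub hT h3
    exact TR.succ hT hv hvp (TR.succ hT hp (hpf (by omega)) h4)

theorem dt_add_two (hT : 0 < T) (hS : IsSelfAdjoint S) {m : ℕ} {f v p : ℝ → H}
    (hf : TR S T (m + 1) (m + 1) f) (hv : TR S T (m + 2) (m + 2) v)
    (hvp : ∀ t ∈ Icc 0 T, HasDerivWithinAt v (p t) (Icc 0 T) t)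
    (hpf : ∀ t ∈ Icc 0 T, HasDerivWithinAt p (f t - ev S (ev S (v t))) (Icc 0 T) t)
    {k : ℕ} (hk : k ≤ m) :
    EqOn (dt (k + 2) T v) (fun t => dt k T f t - ev S (ev S (dt k T v t))) (Icc 0 T) := by
  obtain ⟨h1, h1'⟩ := (hv.of_le (by omega : m ≤ m + 2) le_rfl).ev hT hS (by omega)
  obtain ⟨h2, h2'⟩ := h1.ev hT hS le_rfl
  intro t ht
  rw [dt_succ_eqOn hT hvp _ ht, dt_succ_eqOn hT hpf _ ht,
    dt_sub hT (hf.of_le (by omega : m ≤ m + 1) le_rfl).1 h2.1 hk ht]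
  beta_reduce
  rw [h2' k hk ht]
  beta_reduce
  rw [h1' k hk ht]

end Regularity

/-! ### Uniqueness of weak solutions -/

section Uniqueness

variable {H : Type*} [NormedAddCommGroup H] [InnerProductSpace ℂ H] [CompleteSpace H]
  {A : H →ₗ.[ℂ] H} {T : ℝ} {f : ℝ → H} {g h : H}

theorem IsSolution.hasDerivWithinAt {v : ℝ → H} (hv : IsSolution A T f g h v) :
    ∀ t ∈ Icc 0 T, HasDerivWithinAt v (dt 1 T v t) (Icc 0 T) t := by
  rw [dt_succ, dt_zero]
  exact (timeRegular_iff.1 hv.1).hasDerivWithinAt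

/-- The derivative of the difference d of two solutions need not lie in D(S), so the natural energy
cannot be differentiated. With k = ∫ Sd, integrating the weak equation gives k ∈ D(S) and Sk = -d'.
Thus d' = -Sk, k' = Sd, and symmetry makes ‖d‖² + ‖k‖² constant, hence zero. -/
theorem IsSolution.eqOn (hT : 0 < T) (hS : IsSelfAdjoint (sqrtOp A)) {v w : ℝ → H}
    (hv : IsSolution A T f g h v) (hw : IsSolution A T f g h w) : EqOn w v (Icc 0 T) := by
  set S := sqrtOp A with hSdef
  have h0 : (0 : ℝ) ∈ Icc 0 T := ⟨le_rfl, hT.le⟩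
  let d : ℝ → H := fun t => w t - v t
  let d' : ℝ → H := fun t => dt 1 T w t - dt 1 T v t
  have hd : CDOn S (Icc 0 T) 1 d :=
    (timeRegular_iff.1 hw.1).cdOn.sub (timeRegular_iff.1 hv.1).cdOn
  have hdd : ∀ t ∈ Icc 0 T, HasDerivWithinAt d (d' t) (Icc 0 T) t := fun t ht =>
    (hw.hasDerivWithinAt t ht).sub (hv.hasDerivWithinAt t ht)
  have hd0 : d 0 = 0 := by simp only [d, hw.2.2.1, hv.2.2.1, sub_self]
  have hd0' : d' 0 = 0 := by simp only [d', hw.2.2.2, hv.2.2.2, sub_self]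
  let k : ℝ → H := fun t => ∫ s in (0 : ℝ)..t, ev S (d (clamp T s))
  have hk0 : k 0 = 0 := by simp [k]
  have hk : ∀ t ∈ Icc 0 T, HasDerivWithinAt k (ev S (d t)) (Icc 0 T) t := by
    intro t ht
    have := hasDerivWithinAt_integral_clamp (u := fun t => ev S (d t)) hT.le hd.2.2 0 ht
    simpa only [zero_add] using this
  have hweak : ∀ x y, (x, y) ∈ S.graph → ∀ t ∈ Icc 0 T,
      HasDerivWithinAt (fun t => inner ℂ x (d' t)) (-inner ℂ y (ev S (d t))) (Icc 0 T) t := by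
    intro x y hxy t ht
    have hx := LinearPMap.mem_domain_of_mem_graph hxy
    have := (hw.2.1 x hx t ht).sub (hv.2.1 x hx t ht)
    refine (this.congr_of_mem (fun t _ => ?_) ht).congr_deriv ?_
    · simp only [d', inner_sub_right, Pi.sub_apply]
    · rw [← hSdef, ev_eq hxy, ev_sub ((timeRegular_iff.1 hw.1).cdOn.2.1 t ht)
        ((timeRegular_iff.1 hv.1).cdOn.2.1 t ht), inner_sub_right]
      ring
  have hkg : ∀ t ∈ Icc 0 T, (k t, -d' t) ∈ S.graph := by
    intro t ht
    refine mem_graph_of_inner hS fun x y hxy => ?_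
    have := eq_of_hasDerivWithinAt (fun t ht => inner_hasDerivWithinAt y (hk t ht))
      (fun t ht => ((hweak x y hxy t ht).neg).congr_deriv (neg_neg _))
      (by simp [hk0, hd0']) ht
    simp only [inner_neg_right] at this ⊢
    exact this
  have hE : ∀ t ∈ Icc 0 T, inner ℂ (d t) (d t) + inner ℂ (k t) (k t) = (0 : ℂ) := by
    refine eq_of_hasDerivWithinAt (u' := fun _ => (0 : ℂ)) (fun t ht => ?_)
      (fun t _ => hasDerivWithinAt_const t _ (0 : ℂ)) (by simp [hd0, hk0])
    have h1 := ((hdd t ht).inner ℂ (hdd t ht)).add ((hk t ht).inner ℂ (hk t ht))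
    refine h1.congr_deriv ?_
    have g1 := ev_mem_graph (hd.2.1 t ht)
    have h2 := graph_inner hS g1 (hkg t ht)
    have h3 := graph_inner hS (hkg t ht) g1
    rw [h2, ← h3, inner_neg_left, inner_neg_right]
    ring
  intro t ht
  have h1 := congrArg Complex.re (hE t ht)
  rw [Complex.add_re, Complex.zero_re] at h1
  have h2 : (inner ℂ (d t) (d t)).re = ‖d t‖ ^ 2 := inner_self_eq_norm_sq (𝕜 := ℂ) _
  have h3 : (inner ℂ (k t) (k t)).re = ‖k t‖ ^ 2 := inner_self_eq_norm_sq (𝕜 := ℂ) _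
  rw [h2, h3] at h1
  have h4 : ‖d t‖ ^ 2 = 0 := le_antisymm (by nlinarith [sq_nonneg ‖k t‖]) (sq_nonneg _)
  exact sub_eq_zero.1 (norm_eq_zero.1 (pow_eq_zero_iff two_ne_zero |>.1 h4))

end Uniqueness

/-! ### The a priori estimate and well-posedness -/

section WellPosedness

variable {H : Type*} [NormedAddCommGroup H] [InnerProductSpace ℂ H] [CompleteSpace H]
  {A : H →ₗ.[ℂ] H} {T : ℝ}

theorem domNorm_sub_le {j : ℕ} {x y : H} (hx : InDom (sqrtOp A) j x)
    (hy : InDom (sqrtOp A) j y) : domNorm A j (x - y) ≤ domNorm A j x + domNorm A j y := by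
  have key : ∀ z, InDom (sqrtOp A) j z → domNorm A j z =
      ‖(WithLp.toLp 2 fun i : Fin (j + 1) => (ev (sqrtOp A))^[i] z :
        PiLp 2 fun _ : Fin (j + 1) => H)‖ := by
    intro z hz
    rw [domNorm_eq hz, PiLp.norm_eq_of_L2, Finset.sum_range]
  rw [key _ (hx.sub hy), key _ hx, key _ hy]
  have : (WithLp.toLp 2 fun i : Fin (j + 1) => (ev (sqrtOp A))^[i] (x - y) :
        PiLp 2 fun _ : Fin (j + 1) => H) =
      (WithLp.toLp 2 fun i : Fin (j + 1) => (ev (sqrtOp A))^[i] x) -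
        WithLp.toLp 2 fun i : Fin (j + 1) => (ev (sqrtOp A))^[i] y := by
    ext i
    exact iterate_ev_sub (hx.of_le (Nat.lt_succ_iff.1 i.2)) (hy.of_le (Nat.lt_succ_iff.1 i.2))
  rw [this]
  exact norm_sub_le _ _

theorem domNorm_mono (A : H →ₗ.[ℂ] H) {i j : ℕ} (h : i ≤ j) (x : H) :
    domNorm A i x ≤ domNorm A j x :=
  Real.sqrt_le_sqrt (Finset.sum_le_sum_of_subset_of_nonneg
    (Finset.range_subset_range.2 (by omega)) fun _ _ _ => sq_nonneg _)

theorem domNorm_ev_le {j : ℕ} {x : H} (h : InDom (sqrtOp A) (j + 1) x) :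
    domNorm A j (ev (sqrtOp A) x) ≤ domNorm A (j + 1) x := by
  rw [domNorm_eq h, domNorm_eq h.2, Finset.sum_range_succ' _ (j + 1)]
  exact Real.sqrt_le_sqrt (le_add_of_nonneg_right (sq_nonneg _))

/-- The constant in the a priori estimate. -/
def aprioriConst (m : ℕ) (T : ℝ) : ℝ :=
  (m + 2) * ((m + 2) * ((2 + T) * (1 + T) + 1) + 1)

theorem aprioriConst_pos (m : ℕ) {T : ℝ} (hT : 0 < T) : 0 < aprioriConst m T := by
  unfold aprioriConst; positivity

/-- The estimate of the higher time derivatives by those of order `0` and `1`. -/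
theorem domNorm_dt_le (hT : 0 < T) (hS : IsSelfAdjoint (sqrtOp A)) {m : ℕ} {f v p : ℝ → H}
    (hf : TR (sqrtOp A) T m m f) (hv : TR (sqrtOp A) T (m + 1) (m + 1) v)
    (hvp : ∀ t ∈ Icc 0 T, HasDerivWithinAt v (p t) (Icc 0 T) t)
    (hpf : 1 ≤ m → ∀ t ∈ Icc 0 T,
      HasDerivWithinAt p (f t - ev (sqrtOp A) (ev (sqrtOp A) (v t))) (Icc 0 T) t)
    {B : ℝ} (h0 : ∀ t ∈ Icc 0 T, domNorm A (m + 1) (v t) ≤ B)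
    (h1 : ∀ t ∈ Icc 0 T, domNorm A m (p t) ≤ B) :
    ∀ k ≤ m + 1, ∀ t ∈ Icc 0 T, domNorm A (m + 1 - k) (dt k T v t) ≤
      B + ∑ l ∈ Finset.range k, domNorm A (m - l) (dt l T f t)
  | 0, _, t, ht => by simpa [dt_zero] using h0 t ht
  | 1, _, t, ht => by
    rw [dt_succ_eqOn hT hvp 0 ht, dt_zero, Nat.add_sub_cancel]
    exact (h1 t ht).trans (le_add_of_nonneg_right (Finset.sum_nonneg fun _ _ => domNorm_nonneg _ _ _))
  | k + 2, hk, t, ht => by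
    obtain ⟨m, rfl⟩ : ∃ n, m = n + 1 := ⟨m - 1, by omega⟩
    have ih := domNorm_dt_le hT hS hf hv hvp hpf h0 h1 k (by omega) t ht
    rw [dt_add_two hT hS hf hv hvp (hpf (by omega)) (by omega) ht]
    have e : m + 1 + 1 - k = m + 1 + 1 - (k + 2) + 1 + 1 := by omega
    have i1 := (hv.2 k (by omega)).inDom t ht
    rw [e] at i1 ih
    have i2 := ((hf.2 k (by omega)).inDom t ht).of_le (by omega : m + 1 + 1 - (k + 2) ≤ m + 1 - k)
    have j1 := domNorm_sub_le i2 i1.2.2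
    have j2 := domNorm_ev_le i1
    have j3 := domNorm_ev_le i1.2
    have j4 := domNorm_mono A (by omega : m + 1 + 1 - (k + 2) ≤ m + 1 - k) (dt k T f t)
    -- The recursion goes from k to k + 2 and costs only the summand l = k; the summand l = k + 1 is
    -- added for free.
    have j5 := domNorm_nonneg A (m + 1 - (k + 1)) (dt (k + 1) T f t)
    rw [Finset.sum_range_succ, Finset.sum_range_succ]
    linarith

theorem wellPosed {A : H →ₗ.[ℂ] H} (hA : IsSelfAdjoint A) (hp : IsNonneg A) (m : ℕ) (hT : 0 < T) :
    WellPosed A m T (aprioriConst m T) := by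
  obtain ⟨hS, hSp, -⟩ := sqrtOp_spec hA hp
  intro f g h hg hh hf
  rw [mem_halfPow_domain] at hg hh
  rw [timeRegular_iff] at hf
  -- The source is frozen outside [0,T]. This destroys its smoothness in time, but the global
  -- construction asks only for continuity into D(S^m).
  obtain ⟨v, p, cv, cp, hvp, hv0, hp0, hw, hb⟩ :=
    exists_global_solution hS hSp (hf.cdOn.clamp hT.le) hg hh
  have hvp' : ∀ t ∈ Icc 0 T, HasDerivWithinAt v (p t) (Icc 0 T) t :=
    fun t _ => (hvp t).hasDerivWithinAt
  have hpf : 1 ≤ m → ∀ t ∈ Icc 0 T,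
      HasDerivWithinAt p (f t - ev (sqrtOp A) (ev (sqrtOp A) (v t))) (Icc 0 T) t := by
    -- For m ≥ 1 the values of v lie in D(S²), so the weak equation is a strong one.
    intro hm t ht
    have cv2 := cv.of_le (by omega : 1 + 1 ≤ m + 1)
    have hc := continuousOn_univ.1
      (((hf.cdOn.clamp hT.le).continuousOn).sub cv2.2.2.2.2)
    have := (hasDerivAt_of_weak hS hc (fun x y hxy t => (hw x y hxy t).congr_deriv ?_)
      t).hasDerivWithinAt (s := Icc 0 T)
    · simp only [Pi.sub_apply, clamp_eq ht] at this
      exact this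
    · rw [Pi.sub_apply, inner_sub_right,
        graph_inner hS hxy (ev_mem_graph (cv2.2.2.2.1 t trivial))]
  have cv' : CDOn (sqrtOp A) (Icc 0 T) (m + 1) v :=
    cv.comp (s := univ) (φ := id) continuousOn_id fun _ _ => trivial
  have cp' : CDOn (sqrtOp A) (Icc 0 T) m p := cp.comp (s := univ) (φ := id) continuousOn_id fun _ _ => trivial
  have hTR := TR.bootstrap hT hS hf cv' cp' hvp' hpf m le_rfl
  have hdt1 : EqOn (dt 1 T v) p (Icc 0 T) := by
    have := dt_succ_eqOn hT hvp' 0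
    rwa [dt_zero] at this
  have hsol : IsSolution A T f g h v := by
    refine ⟨timeRegular_iff.2 (hTR.of_le (by omega) (by omega)), fun w hw' t ht => ?_, hv0, ?_⟩
    · have := (hw w _ (ev_mem_graph hw') t).hasDerivWithinAt (s := Icc 0 T)
      rw [clamp_eq ht] at this
      exact this.congr_of_mem (fun s hs => by rw [hdt1 hs]) ht
    · rw [hdt1 ⟨le_rfl, hT.le⟩, hp0]
  refine ⟨v, hsol, timeRegular_iff.2 hTR, fun w hw => hsol.eqOn hT hS hw, ?_⟩
  set Φ := ∑ k ∈ Finset.range (m + 1), supDomNorm A (m - k) T (dt k T f) with hΦ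
  have hsup : ∀ k ≤ m, ∀ t ∈ Icc 0 T, domNorm A (m - k) (dt k T f t) ≤
      supDomNorm A (m - k) T (dt k T f) := fun k hk t ht => domNorm_le_supDomNorm (hf.2 k hk) ht
  have h0T : (0 : ℝ) ∈ Icc 0 T := ⟨le_rfl, hT.le⟩
  have hnn : ∀ k ∈ Finset.range (m + 1), 0 ≤ supDomNorm A (m - k) T (dt k T f) := fun k hk =>
    (domNorm_nonneg _ _ _).trans (hsup k (by rw [Finset.mem_range] at hk; omega) 0 h0T)
  have hΦ0 : 0 ≤ Φ := Finset.sum_nonneg hnn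
  have hg0 := domNorm_nonneg A (m + 1) g
  have hh0 := domNorm_nonneg A m h
  set M := Φ + domNorm A (m + 1) g + domNorm A m h with hM
  have hM0 : 0 ≤ M := by positivity
  have hb' := hb M
    (fun i hi s => by
      have h1 := iterate_le_domNorm (hf.cdOn.inDom _ (clamp_mem hT.le s)) hi
      have h2 := hsup 0 (Nat.zero_le _) _ (clamp_mem hT.le s)
      have h3 : supDomNorm A (m - 0) T (dt 0 T f) ≤ Φ :=
        Finset.single_le_sum hnn (Finset.mem_range.2 (Nat.succ_pos m))
      rw [dt_zero, Nat.sub_zero] at h2 h3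
      linarith)
    (fun i hi => by have := iterate_le_domNorm hh hi; linarith)
    (fun i hi => by have := iterate_le_domNorm hg hi; linarith)
  have habs : ∀ t ∈ Icc 0 T, (2 + |t|) * M ≤ (2 + T) * M := fun t ht => by
    rw [abs_of_nonneg ht.1]
    exact mul_le_mul_of_nonneg_right (by linarith [ht.2]) hM0
  -- L must dominate both 2 + T, from the bounds on S^i v' and S^{i+1} v, and 1 + T(2 + T), from ‖v‖
  -- ≤ ‖g‖ + T sup ‖v'‖.
  set L := (2 + T) * (1 + T) + 1 with hL
  have hTM : 0 ≤ T * M := by positivity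
  have hTTM : 0 ≤ T * (T * M) := by positivity
  have hLM : (2 + T) * M ≤ L * M := by rw [hL]; nlinarith
  have hLM0 : 0 ≤ L * M := by positivity
  have hv00 : ∀ t ∈ Icc 0 T, ‖v t‖ ≤ L * M := by
    intro t ht
    have h1 := Convex.norm_image_sub_le_of_norm_hasDerivWithin_le hvp'
      (C := (2 + T) * M) (fun s hs => (hb' s 0 (Nat.zero_le _)).1.trans (habs s hs))
      (convex_Icc 0 T) h0T ht
    rw [hv0, sub_zero, Real.norm_of_nonneg ht.1] at h1
    have h2 := iterate_le_domNorm hg (Nat.zero_le _)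
    rw [Function.iterate_zero, id_eq] at h2
    have h3 := norm_le_insert' (v t) g
    have h4 : (2 + T) * M * t ≤ (2 + T) * M * T :=
      mul_le_mul_of_nonneg_left ht.2 (by positivity)
    rw [hL]
    nlinarith
  have e0 : ∀ t ∈ Icc 0 T, domNorm A (m + 1) (v t) ≤ (m + 2) * (L * M) := by
    intro t ht
    have := domNorm_le hLM0 (cv'.inDom t ht) (by
      rintro (_ | i) hi
      · exact hv00 t ht
      · exact (hb' t i (by omega)).2.trans ((habs t ht).trans hLM))
    push_cast at this
    linarith
  have e1 : ∀ t ∈ Icc 0 T, domNorm A m (p t) ≤ (m + 2) * (L * M) := by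
    intro t ht
    have := domNorm_le hLM0 (cp'.inDom t ht) fun i hi =>
      (hb' t i hi).1.trans ((habs t ht).trans hLM)
    linarith
  -- The first term bounds the derivatives of order 0 and 1, the summand M absorbs the derivatives
  -- of f picked up by the recursion. Summing over the m + 2 orders gives `aprioriConst`.
  have e2 : ∀ k ∈ Finset.range (m + 2), supDomNorm A (m + 1 - k) T (dt k T v) ≤
      (m + 2) * (L * M) + M := by
    intro k hk
    rw [Finset.mem_range] at hk
    refine supDomNorm_le hT.le fun t ht => ?_
    refine (domNorm_dt_le hT hS hf hTR hvp' hpf e0 e1 k (by omega) t ht).trans ?_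
    have h1 : ∑ l ∈ Finset.range k, domNorm A (m - l) (dt l T f t) ≤ Φ :=
      calc ∑ l ∈ Finset.range k, domNorm A (m - l) (dt l T f t)
          ≤ ∑ l ∈ Finset.range (m + 1), domNorm A (m - l) (dt l T f t) :=
            Finset.sum_le_sum_of_subset_of_nonneg (Finset.range_subset_range.2 (by omega))
              fun _ _ _ => domNorm_nonneg _ _ _
        _ ≤ Φ := Finset.sum_le_sum fun l hl =>
            hsup l (by rw [Finset.mem_range] at hl; omega) t ht
    linarith
  refine (Finset.sum_le_card_nsmul _ _ _ e2).trans_eq ?_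
  rw [Finset.card_range, nsmul_eq_mul, aprioriConst]
  push_cast
  ring

end WellPosedness

/-! ### Test functions: density and uniqueness of the weak gradient -/

section TestFunctions

variable {N : ℕ} {Ω : Set (EuclideanSpace ℝ (Fin N))}

theorem inner_toLp {φ : EuclideanSpace ℝ (Fin N) → ℂ} (hφ : MemLp φ 2 (volume.restrict Ω))
    (f : L2 Ω) : inner ℂ (hφ.toLp φ) f = ∫ x in Ω, f x * conj (φ x) := by
  rw [L2.inner_def]
  refine integral_congr_ae ?_
  filter_upwards [hφ.coeFn_toLp] with x hx
  rw [hx, RCLike.inner_apply]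

theorem setIntegral_mul_eq {φ ψ : EuclideanSpace ℝ (Fin N) → ℂ} (h : tsupport ψ ⊆ Ω) :
    ∫ x in Ω, φ x * ψ x = ∫ x, φ x * ψ x := by
  refine setIntegral_eq_integral_of_forall_compl_eq_zero fun x hx => ?_
  rw [image_eq_zero_of_notMem_tsupport fun h' => hx (h h'), mul_zero]

open scoped ContDiff in
/-- Real test functions on `Ω` separate the elements of `L²(Ω)`. -/
theorem eq_zero_of_inner_test (hΩ : IsOpen Ω) (f : L2 Ω)
    (h : ∀ ψ : EuclideanSpace ℝ (Fin N) → ℝ, ContDiff ℝ ∞ ψ → HasCompactSupport ψ →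
      tsupport ψ ⊆ Ω → ∫ x in Ω, f x * (ψ x : ℂ) = 0) : f = 0 := by
  have hf : LocallyIntegrableOn f Ω volume := by
    refine LocallyIntegrableOn.mono_set ?_ subset_rfl
    intro x hx
    have h1 : LocallyIntegrable f (volume.restrict Ω) := (Lp.memLp f).locallyIntegrable (by norm_num)
    exact (locallyIntegrableOn_of_locallyIntegrable_restrict h1) x hx
  have h1 := hΩ.ae_eq_zero_of_integral_contDiff_smul_eq_zero hf fun ψ h1 h2 h3 => by
    rw [← h ψ h1 h2 h3, setIntegral_eq_integral_of_forall_compl_eq_zero]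
    · refine integral_congr_ae (ae_of_all _ fun x => ?_)
      simp only [Complex.real_smul, mul_comm]
    · intro x hx
      rw [image_eq_zero_of_notMem_tsupport fun h' => hx (h3 h'), Complex.ofReal_zero, mul_zero]
  rw [Lp.eq_zero_iff_ae_eq_zero]
  exact (ae_restrict_iff' hΩ.measurableSet).2 h1

variable {ψ : EuclideanSpace ℝ (Fin N) → ℝ}

open scoped ContDiff in
theorem contDiff_ofReal_comp (hψ : ContDiff ℝ ∞ ψ) : ContDiff ℝ ∞ fun x => (ψ x : ℂ) :=
  Complex.ofRealCLM.contDiff.comp hψ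

theorem hasCompactSupport_ofReal_comp (hψ : HasCompactSupport ψ) :
    HasCompactSupport fun x => (ψ x : ℂ) :=
  hψ.comp_left (g := ((↑) : ℝ → ℂ)) Complex.ofReal_zero

theorem tsupport_ofReal_comp : tsupport (fun x => (ψ x : ℂ)) = tsupport ψ := by
  unfold tsupport
  congr 1
  ext x
  simp

theorem hasCompactSupport_fderiv_apply {φ : EuclideanSpace ℝ (Fin N) → ℂ}
    (h : HasCompactSupport φ) (e : EuclideanSpace ℝ (Fin N)) :
    HasCompactSupport fun x => fderiv ℝ φ x e :=
  (h.fderiv ℝ).comp_left (g := fun L : EuclideanSpace ℝ (Fin N) →L[ℝ] ℂ => L e) rfl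

open scoped ContDiff in
theorem continuous_fderiv_apply {φ : EuclideanSpace ℝ (Fin N) → ℂ} (h : ContDiff ℝ ∞ φ)
    (e : EuclideanSpace ℝ (Fin N)) : Continuous fun x => fderiv ℝ φ x e :=
  (h.continuous_fderiv (by simp)).clm_apply continuous_const

open scoped ContDiff in
/-- Every test function gives an element of `H_0^1`. -/
theorem exists_mem_H01 {φ : EuclideanSpace ℝ (Fin N) → ℂ} (h1 : ContDiff ℝ ∞ φ)
    (h2 : HasCompactSupport φ) (h3 : tsupport φ ⊆ Ω) :
    ∃ G, ((h1.continuous.memLp_of_hasCompactSupport h2 : MemLp φ 2 (volume.restrict Ω)).toLp φ, G) ∈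
      H01 Ω := by
  have hG : ∀ i : Fin N, MemLp (fun x => fderiv ℝ φ x (EuclideanSpace.single i 1)) 2
      (volume.restrict Ω) := fun i =>
    (continuous_fderiv_apply h1 _).memLp_of_hasCompactSupport (hasCompactSupport_fderiv_apply h2 _)
  exact ⟨fun i => (hG i).toLp _, (testPairs Ω).le_topologicalClosure
    ⟨φ, h1, h2, h3,
      (h1.continuous.memLp_of_hasCompactSupport h2).coeFn_toLp, fun i => (hG i).coeFn_toLp⟩⟩

/-- `C_c^∞(Ω)`, hence `H_0^1(Ω)`, is dense in `L²(Ω)`. -/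
theorem eq_zero_of_inner_H01 (hΩ : IsOpen Ω) (w : L2 Ω)
    (h : ∀ q ∈ H01 Ω, inner ℂ q.1 w = 0) : w = 0 := by
  refine eq_zero_of_inner_test hΩ w fun ψ h1 h2 h3 => ?_
  obtain ⟨G, hG⟩ := exists_mem_H01 (contDiff_ofReal_comp h1) (hasCompactSupport_ofReal_comp h2)
    (tsupport_ofReal_comp.subset.trans h3)
  have h4 := h _ hG
  rw [inner_toLp] at h4
  simpa using h4

/-- The weak gradient of an element of `H_0^1` is unique. -/
theorem eq_zero_of_mem_H01 (hΩ : IsOpen Ω) {G : Fin N → L2 Ω} (h : (0, G) ∈ H01 Ω) : G = 0 := by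
  funext i
  refine eq_zero_of_inner_test hΩ (G i) fun ψ h1 h2 h3 => ?_
  set e : EuclideanSpace ℝ (Fin N) := EuclideanSpace.single i 1
  set φ : EuclideanSpace ℝ (Fin N) → ℂ := fun x => (ψ x : ℂ) with hφ
  have d1 := contDiff_ofReal_comp h1
  have d2 := hasCompactSupport_ofReal_comp h2
  have d3 : tsupport φ ⊆ Ω := tsupport_ofReal_comp.subset.trans h3
  have m1 : MemLp φ 2 (volume.restrict Ω) := d1.continuous.memLp_of_hasCompactSupport d2
  have m2 : MemLp (fun x => fderiv ℝ φ x e) 2 (volume.restrict Ω) :=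
    (continuous_fderiv_apply d1 e).memLp_of_hasCompactSupport (hasCompactSupport_fderiv_apply d2 e)
  have hreal : ∀ x, conj (fderiv ℝ φ x e) = fderiv ℝ φ x e := by
    intro x
    have h4 : HasFDerivAt φ (Complex.ofRealCLM.comp (fderiv ℝ ψ x)) x :=
      Complex.ofRealCLM.hasFDerivAt.comp x ((h1.differentiable (by simp)) x).hasFDerivAt
    rw [h4.fderiv]
    exact Complex.conj_ofReal _
  -- Integration by parts says that Λ(u, G) = ⟨φ, Gᵢ⟩ + ⟨∂ᵢφ, u⟩ vanishes on test pairs; being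
  -- continuous, it vanishes on their closure. At u = 0 this leaves ⟨φ, Gᵢ⟩ = 0.
  let Λ : (L2 Ω × (Fin N → L2 Ω)) →L[ℂ] ℂ :=
    (innerSL ℂ (m1.toLp φ)).comp ((ContinuousLinearMap.proj i).comp
      (ContinuousLinearMap.snd ℂ (L2 Ω) (Fin N → L2 Ω))) +
    (innerSL ℂ (m2.toLp _)).comp (ContinuousLinearMap.fst ℂ (L2 Ω) (Fin N → L2 Ω))
  have hΛ : ∀ p, Λ p = inner ℂ (m1.toLp φ) (p.2 i) + inner ℂ (m2.toLp _) p.1 := fun p => rfl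
  have hker : H01 Ω ≤ Λ.ker := by
    refine Submodule.topologicalClosure_minimal _ ?_ Λ.isClosed_ker
    rintro p ⟨χ, k1, k2, k3, k4, k5⟩
    change Λ p = 0
    rw [hΛ, inner_toLp, inner_toLp]
    have i1 : ∫ x in Ω, p.2 i x * conj (φ x) = ∫ x, φ x * fderiv ℝ χ x e := by
      rw [← integral_congr_ae (μ := volume), ← setIntegral_mul_eq (φ := fun x => fderiv ℝ χ x e) d3]
      · refine integral_congr_ae ?_
        filter_upwards [k5 i] with x hx
        rw [hx, hφ, Complex.conj_ofReal]
      · exact ae_of_all _ fun x => mul_comm _ _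
    have i2 : ∫ x in Ω, p.1 x * conj (fderiv ℝ φ x e) = ∫ x, fderiv ℝ φ x e * χ x := by
      rw [← setIntegral_mul_eq k3]
      refine integral_congr_ae ?_
      filter_upwards [k4] with x hx
      rw [hx, hreal, mul_comm]
    have c1 := continuous_fderiv_apply k1 e
    have c2 := continuous_fderiv_apply d1 e
    have i3 := integral_mul_fderiv_eq_neg_fderiv_mul_of_integrable (μ := volume) (f := φ) (g := χ)
      (v := e)
      ((c2.mul k1.continuous).integrable_of_hasCompactSupport k2.mul_left)
      ((d1.continuous.mul c1).integrable_of_hasCompactSupport d2.mul_right)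
      ((d1.continuous.mul k1.continuous).integrable_of_hasCompactSupport d2.mul_right)
      (fun x _ => d1.differentiable (by simp) x) (fun x _ => k1.differentiable (by simp) x)
    rw [i1, i2, i3, neg_add_cancel]
  have h4 : Λ (0, G) = 0 := hker h
  rw [hΛ, inner_zero_right, add_zero, inner_toLp] at h4
  simpa [hφ] using h4

end TestFunctions

/-! ### Self-adjointness of the divergence-form operator -/

section DivergenceForm

variable {N : ℕ} {Ω : Set (EuclideanSpace ℝ (Fin N))}

/-- Multiplication by `√c` is bounded on `L²(Ω)`, with bounded inverse. -/
theorem Conductivity.exists_mul_sqrt (c : Conductivity Ω) :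
    ∃ M : L2 Ω →L[ℂ] L2 Ω, (∃ K : ℝ, 0 ≤ K ∧ ∀ a, ‖a‖ ≤ K * ‖M a‖) ∧
      ∀ a b, ∫ x in Ω, (c.toFun x : ℂ) * (b x * conj (a x)) = inner ℂ (M a) (M b) := by
  obtain ⟨cm, h0, h1⟩ := c.elliptic
  obtain ⟨cM, h2⟩ := c.bounded
  have hmeas : AEStronglyMeasurable (fun x => ((√(c.toFun x) : ℝ) : ℂ)) (volume.restrict Ω) :=
    (Complex.measurable_ofReal.comp_aemeasurable
      (Real.continuous_sqrt.measurable.comp_aemeasurable c.aemeasurable)).aestronglyMeasurable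
  have hle : ∀ a : L2 Ω, ∀ᵐ x ∂(volume.restrict Ω),
      ‖((√(c.toFun x) : ℝ) : ℂ) * a x‖ ≤ √cM * ‖a x‖ := by
    intro a
    filter_upwards [h2] with x hx
    rw [norm_mul, Complex.norm_real, Real.norm_of_nonneg (Real.sqrt_nonneg _)]
    gcongr
  have hmem : ∀ a : L2 Ω, MemLp (fun x => ((√(c.toFun x) : ℝ) : ℂ) * a x) 2 (volume.restrict Ω) :=
    fun a => (Lp.memLp a).of_le_mul (hmeas.mul (Lp.aestronglyMeasurable a)) (hle a)
  let M₀ : L2 Ω →ₗ[ℂ] L2 Ω :=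
    { toFun := fun a => (hmem a).toLp _
      map_add' := fun a b => by
        rw [← MemLp.toLp_add, MemLp.toLp_eq_toLp_iff]
        filter_upwards [Lp.coeFn_add a b] with x hx
        rw [hx]
        simp only [Pi.add_apply, mul_add]
      map_smul' := fun r a => by
        rw [RingHom.id_apply, ← MemLp.toLp_const_smul, MemLp.toLp_eq_toLp_iff]
        filter_upwards [Lp.coeFn_smul r a] with x hx
        rw [hx]
        simp only [Pi.smul_apply, smul_eq_mul]
        ring }
  have hM₀ : ∀ a, M₀ a =ᵐ[volume.restrict Ω] fun x => ((√(c.toFun x) : ℝ) : ℂ) * a x :=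
    fun a => (hmem a).coeFn_toLp
  refine ⟨M₀.mkContinuous √cM fun a => Lp.norm_le_mul_norm_of_ae_le_mul ?_,
    ⟨(√cm)⁻¹, by positivity, fun a => Lp.norm_le_mul_norm_of_ae_le_mul ?_⟩, fun a b => ?_⟩
  · filter_upwards [hM₀ a, hle a] with x hx hx'
    rw [hx]
    exact hx'
  · rw [LinearMap.mkContinuous_apply]
    filter_upwards [hM₀ a, h1] with x hx hx'
    rw [hx, norm_mul, Complex.norm_real, Real.norm_of_nonneg (Real.sqrt_nonneg _),
      inv_mul_eq_div, le_div_iff₀ (Real.sqrt_pos.2 h0), mul_comm]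
    gcongr
  · rw [LinearMap.mkContinuous_apply, LinearMap.mkContinuous_apply, L2.inner_def]
    refine integral_congr_ae ?_
    filter_upwards [hM₀ a, hM₀ b, h1] with x hx hx' hc
    have hs : ((√(c.toFun x) : ℝ) : ℂ) * ((√(c.toFun x) : ℝ) : ℂ) = (c.toFun x : ℂ) := by
      rw [← Complex.ofReal_mul, Real.mul_self_sqrt (h0.le.trans hc)]
    rw [hx, hx', RCLike.inner_apply, map_mul, Complex.conj_ofReal, ← hs]
    ring

variable (c : Conductivity Ω)

/-- A submodule is the graph of its `toLinearPMap` only if it is single-valued. Here u = 0 forces G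
= 0 by closability of the gradient, and then w is orthogonal to the dense space H_0^1, so w = 0. -/
theorem mem_divOp_graph (hΩ : IsOpen Ω) {u w : L2 Ω} :
    (u, w) ∈ (divOp c).graph ↔
      ∃ G, (u, G) ∈ H01 Ω ∧ ∀ q ∈ H01 Ω, energy c q.2 G = inner ℂ q.1 w := by
  rw [divOp, Submodule.toLinearPMap_graph_eq]
  · rfl
  · rintro ⟨u, w⟩ ⟨G, hG, h⟩ hu
    simp only at hu hG h
    subst hu
    obtain rfl := eq_zero_of_mem_H01 hΩ hG
    refine eq_zero_of_inner_H01 hΩ w fun q hq => ?_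
    rw [← h q hq]
    simpa using energy_smul c q.2 0 0

theorem energy_conj_symm (Ψ G : Fin N → L2 Ω) : conj (energy c Ψ G) = energy c G Ψ := by
  obtain ⟨M, -, hM⟩ := c.exists_mul_sqrt
  simp only [energy, hM, map_sum, inner_conj_symm]

theorem energy_self_nonneg (G : Fin N → L2 Ω) : 0 ≤ (energy c G G).re := by
  obtain ⟨M, -, hM⟩ := c.exists_mul_sqrt
  simp only [energy, hM, Complex.re_sum]
  exact Finset.sum_nonneg fun i _ => inner_self_nonneg (𝕜 := ℂ)

theorem isNonneg_divOp (hΩ : IsOpen Ω) : IsNonneg (divOp c) := by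
  refine isNonneg_of_graph fun u w h => ?_
  obtain ⟨G, hG, h⟩ := (mem_divOp_graph c hΩ).1 h
  have h1 := h _ hG
  have h2 := energy_self_nonneg c G
  rw [h1, ← inner_conj_symm, Complex.conj_re] at h2
  exact h2

/-- Solvability of `u + A_c u = w`, by projection in `L²(Ω)^(1+N)`. -/
theorem exists_resolvent_divOp (hΩ : IsOpen Ω) (w : L2 Ω) :
    ∃ u, (u, w - u) ∈ (divOp c).graph := by
  obtain ⟨M, ⟨K, hK0, hK⟩, hM⟩ := c.exists_mul_sqrt
  let X := PiLp 2 fun _ : Option (Fin N) => L2 Ω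
  let Φ₀ : (L2 Ω × (Fin N → L2 Ω)) →L[ℂ] (Option (Fin N) → L2 Ω) :=
    ContinuousLinearMap.pi fun o => o.elim (ContinuousLinearMap.fst ℂ _ _)
      fun i => M.comp ((ContinuousLinearMap.proj i).comp (ContinuousLinearMap.snd ℂ _ _))
  -- The map (u, G) ↦ (u, √c G) goes from a product with the sup norm to a genuine Hilbert space,
  -- whose inner product is the form plus the L² product. It is bounded below, so the image of H_0^1
  -- is complete and admits an orthogonal projection.
  let Φ : (L2 Ω × (Fin N → L2 Ω)) →L[ℂ] X :=
    ((PiLp.continuousLinearEquiv 2 ℂ fun _ : Option (Fin N) => L2 Ω).symm :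
      (Option (Fin N) → L2 Ω) →L[ℂ] X).comp Φ₀
  have hΦn : ∀ p, Φ p none = p.1 := fun p => rfl
  have hΦs : ∀ p i, Φ p (some i) = M (p.2 i) := fun p i => rfl
  have hanti : AntilipschitzWith (max 1 K).toNNReal Φ := by
    refine Φ.antilipschitz_of_bound fun p => ?_
    rw [Real.coe_toNNReal _ (by positivity)]
    refine max_le ?_ ((pi_norm_le_iff_of_nonneg (by positivity)).2 fun i => ?_)
    · have := PiLp.norm_apply_le (Φ p) none
      rw [hΦn] at this
      exact this.trans (le_mul_of_one_le_left (norm_nonneg _) (le_max_left _ _))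
    · have := PiLp.norm_apply_le (Φ p) (some i)
      rw [hΦs] at this
      calc ‖p.2 i‖ ≤ K * ‖M (p.2 i)‖ := hK _
        _ ≤ max 1 K * ‖Φ p‖ := by gcongr; exact le_max_right _ _
  let W : Submodule ℂ X := (H01 Ω).map Φ.toLinearMap
  have hW : IsComplete (W : Set X) := by
    have h1 : IsComplete (H01 Ω : Set (L2 Ω × (Fin N → L2 Ω))) :=
      (Submodule.isClosed_topologicalClosure _).isComplete
    have h2 := (hanti.isUniformInducing Φ.uniformContinuous).isComplete_iff.2 h1
    exact h2
  have : CompleteSpace W := hW.completeSpace_coe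
  -- If (u, √c G) is the projection of (w, 0), orthogonality of the residual (w - u, -√c G) to the
  -- image is exactly the weak form of u + Au = w.
  let k : X := WithLp.toLp 2 fun o => o.elim w fun _ => 0
  obtain ⟨⟨u, G⟩, hp, hpk⟩ := (W.starProjection_apply_mem k : W.starProjection k ∈ W)
  refine ⟨u, (mem_divOp_graph c hΩ).2 ⟨G, hp, fun q hq => ?_⟩⟩
  have h1 := W.sub_starProjection_mem_orthogonal k (Φ q) ⟨q, hq, rfl⟩
  rw [← hpk, PiLp.inner_apply, Fintype.sum_option] at h1
  have h2 : inner ℂ q.1 (w - u) + ∑ i, inner ℂ (M (q.2 i)) (0 - M (G i)) = 0 := h1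
  simp only [zero_sub, inner_neg_right, Finset.sum_neg_distrib, ← hM] at h2
  exact (add_neg_eq_zero.1 h2).symm

theorem isSelfAdjoint_divOp (hΩ : IsOpen Ω) : IsSelfAdjoint (divOp c) := by
  refine isSelfAdjoint_of_symm_of_range (isNonneg_divOp c hΩ) (fun x y z u h h' => ?_)
    (exists_resolvent_divOp c hΩ)
  obtain ⟨G, hG, h⟩ := (mem_divOp_graph c hΩ).1 h
  obtain ⟨G', hG', h'⟩ := (mem_divOp_graph c hΩ).1 h'
  have h1 := h _ hG'
  have h2 := h' _ hG
  simp only at h1 h2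
  rw [← h2, ← inner_conj_symm, ← h1, energy_conj_symm]

end DivergenceForm

theorem isOpen_cylinder {d : ℕ} {ω : Set (EuclideanSpace ℝ (Fin d))} (h : IsOpen ω) :
    IsOpen (cylinder ω) :=
  h.preimage (f := fun x : EuclideanSpace ℝ (Fin (d + 1)) =>
    WithLp.toLp 2 fun i : Fin d => x i.castSucc) (by fun_prop)

end

end HypReg

theorem theorem2p3 (m : ℕ) (T : ℝ) (hT : 0 < T) :
    ∃ C : ℝ, 0 < C ∧
      (∀ (H : Type*) [NormedAddCommGroup H] [InnerProductSpace ℂ H] [CompleteSpace H]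
        (A : H →ₗ.[ℂ] H), IsSelfAdjoint A → HypReg.IsNonneg A → HypReg.WellPosed A m T C) ∧
      (∀ (d : ℕ) (ω : Set (EuclideanSpace ℝ (Fin d))), 1 ≤ d → IsOpen ω →
        Bornology.IsBounded ω → ∀ c : HypReg.Conductivity (HypReg.cylinder ω),
          IsSelfAdjoint (HypReg.divOp c) ∧ HypReg.IsNonneg (HypReg.divOp c) ∧
          HypReg.WellPosed (HypReg.divOp c) m T C) := by
  refine ⟨HypReg.aprioriConst m T, HypReg.aprioriConst_pos m hT, ?_, ?_⟩
  · intro H _ _ _ A hA hp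
    exact HypReg.wellPosed hA hp m hT
  · intro d ω _ hω _ c
    have hΩ := HypReg.isOpen_cylinder hω
    have hA := HypReg.isSelfAdjoint_divOp c hΩ
    have hp := HypReg.isNonneg_divOp c hΩ
    exact ⟨hA, hp, HypReg.wellPosed hA hp m hT⟩
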